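/- Let $k\ge 1$. A $k$-tree is a finite simple graph $G$ whose vertices can be ordered $v_1,\dots,v_n$, $n\ge k+1$, such that $v_1,\dots,v_{k+1}$ form a clique and, for every $i\ge k+2$, the neighbours of $v_i$ among $v_1,\dots,v_{i-1}$ are exactly the vertices of a $k$-clique. A crossing-free straight-line drawing of a graph maps its vertices injectively to points of the plane and its edges to the straight-line segments connecting the corresponding points, such that no edge contains a vertex other than its endpoints and two distinct edges intersect at most in common endpoints. A segment of such a drawing is an inclusion-maximal set of edges whose union is a line segment, and the segment number $\operatorname{seg}(G)$ of a planar graph $G$ is the smallest number of segments over all crossing-free straight-line drawings of $G$. Theorem. For every planar 3-tree $G$ with $n\ge 6$ vertices, $\operatorname{seg}(G)\ge n+4$. -/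

import Mathlib

/-- The Euclidean plane. -/
abbrev Plane : Type := EuclideanSpace ℝ (Fin 2)

namespace SimpleGraph

/-- `G` is a `k`-tree: its vertices have an order (a stacking order) whose first `k + 1` vertices
form a clique, and in which every later vertex is adjacent, among the vertices before it, to exactly
the vertices of some `k`-clique. -/
def IsKTree {V : Type*} [Fintype V] (k : ℕ) (G : SimpleGraph V) : Prop :=
  k + 1 ≤ Fintype.card V ∧
    ∃ σ : Fin (Fintype.card V) ≃ V,
      G.IsClique (σ '' {i | i.val < k + 1}) ∧
      ∀ i : Fin (Fintype.card V), k + 1 ≤ i.val →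
        ∃ Q : Finset V, G.IsNClique k Q ∧ G.neighborSet (σ i) ∩ σ '' {j | j < i} = (Q : Set V)

/-- Placing every vertex `v` at the point `p v` and drawing every edge `e` as the point set `A e`
is injective on the vertices and crossing-free: an edge contains no vertex other than its
endpoints, and two distinct edges meet at most in common endpoints. -/
def IsCrossingFree {V : Type*} (G : SimpleGraph V) (p : V → Plane) (A : Sym2 V → Set Plane) :
    Prop :=
  Function.Injective p ∧
    (∀ e ∈ G.edgeSet, ∀ v : V, p v ∈ A e → v ∈ e) ∧
    ∀ e ∈ G.edgeSet, ∀ f ∈ G.edgeSet, e ≠ f → A e ∩ A f ⊆ p '' {v | v ∈ e ∧ v ∈ f}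

/-- `G` is planar: it has a crossing-free drawing in the plane in which every edge is a simple
curve between its endpoints. -/
def IsPlanar {V : Type*} (G : SimpleGraph V) : Prop :=
  ∃ (p : V → Plane) (A : Sym2 V → Set Plane),
    (∀ u v : V, G.Adj u v →
      ∃ γ : _root_.Path (p u) (p v), Function.Injective γ ∧ Set.range γ = A s(u, v)) ∧
    G.IsCrossingFree p A

/-- The closed straight-line segment that represents the pair `e` when `v` is placed at `p v`. -/
def edgeSegment {V : Type*} (p : V → Plane) (e : Sym2 V) : Set Plane :=
  Sym2.lift ⟨fun u v => segment ℝ (p u) (p v), fun u v => segment_symm ℝ (p u) (p v)⟩ e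

/-- The vertex placement `p` gives a crossing-free straight-line drawing of `G`. -/
def IsStraightLineDrawing {V : Type*} (G : SimpleGraph V) (p : V → Plane) : Prop :=
  G.IsCrossingFree p (edgeSegment p)

/-- The edges in `S` together form a line segment in the straight-line drawing `p` of `G`. -/
def FormsSegment {V : Type*} (G : SimpleGraph V) (p : V → Plane) (S : Set (Sym2 V)) : Prop :=
  S ⊆ G.edgeSet ∧ ∃ a b : Plane, a ≠ b ∧ (⋃ e ∈ S, edgeSegment p e) = segment ℝ a b

/-- The segments of the straight-line drawing `p` of `G`: the maximal sets of edges that together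
form a line segment. -/
def drawingSegments {V : Type*} (G : SimpleGraph V) (p : V → Plane) : Set (Set (Sym2 V)) :=
  {S | Maximal (G.FormsSegment p) S}

/-- The segment number of `G`: the smallest number of segments of a crossing-free straight-line
drawing of `G` (it is `⊤` exactly for graphs that have no such drawing or only drawings with
infinitely many segments). -/
noncomputable def segmentNumber {V : Type*} (G : SimpleGraph V) : ℕ∞ :=
  ⨅ (p : V → Plane) (_ : G.IsStraightLineDrawing p), (G.drawingSegments p).encard

end SimpleGraph

/-! Call a directed edge a port if it is not continued straight beyond its head. A port is an end of
the segment containing its edge, and a segment has two ends, so a drawing has at least half as many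
segments as ports (`card_le_two_mul_encard_drawingSegments`). It therefore suffices to find 2n + 7
ports in every drawing.

Following the stacking order, the drawing is seen to be a triangulation: a triangle `T` divided into
2n - 5 empty triangles (`exists_isTriangulated`). A vertex placed inside `T` falls into a face and
is joined to exactly its corners. A vertex placed outside is joined to exactly the corners of `T`,
and one of these corners is swallowed by the new outer triangle. In both cases each new face is
entered by prolonging an edge beyond the centre of the subdivision.

Such an edge is a port, since an empty face contains no part of an edge. Interiors of faces are
disjoint, so this gives 2n - 5 distinct ports, all ending at inner vertices (`exists_port`). A
corner of `T` is an extreme point of the drawing, so every edge ends there; the degrees of the three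
corners sum to at least 12 when n ≥ 6 (`twelve_le_sum_degreeIn`). The total is (2n - 5) + 12 = 2n +
7. -/

open Filter Topology

/-! ### Simplices in barycentric coordinates -/

section Faces

variable {V E : Type*} [AddCommGroup E] [Module ℝ E]

/-- The closed simplex spanned by the points `p v`, `v ∈ f`. -/
def closedFace (p : V → E) (f : Finset V) : Set E :=
  {P | ∃ c : V → ℝ, (∀ v ∈ f, 0 ≤ c v) ∧ ∑ v ∈ f, c v = 1 ∧ ∑ v ∈ f, c v • p v = P}

/-- The relative interior of the simplex spanned by the points `p v`, `v ∈ f`. -/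
def openFace (p : V → E) (f : Finset V) : Set E :=
  {P | ∃ c : V → ℝ, (∀ v ∈ f, 0 < c v) ∧ ∑ v ∈ f, c v = 1 ∧ ∑ v ∈ f, c v • p v = P}

/-- The points `p v`, `v ∈ f`, are affinely independent. -/
def InGeneralPosition (p : V → E) (f : Finset V) : Prop :=
  ∀ c : V → ℝ, ∑ v ∈ f, c v = 0 → ∑ v ∈ f, c v • p v = 0 → ∀ v ∈ f, c v = 0

theorem openFace_subset_closedFace (p : V → E) (f : Finset V) :
    openFace p f ⊆ closedFace p f := by
  rintro P ⟨c, hc, h⟩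
  exact ⟨c, fun v hv => (hc v hv).le, h⟩

theorem InGeneralPosition.coord_unique {p : V → E} {f : Finset V} (h : InGeneralPosition p f)
    {c d : V → ℝ} (hs : ∑ v ∈ f, c v = ∑ v ∈ f, d v)
    (hp : ∑ v ∈ f, c v • p v = ∑ v ∈ f, d v • p v) : ∀ v ∈ f, c v = d v := by
  intro v hv
  refine sub_eq_zero.1 (h (fun v => c v - d v) ?_ ?_ v hv)
  · rw [Finset.sum_sub_distrib, hs, sub_self]
  · simp only [sub_smul]
    rw [Finset.sum_sub_distrib, hp, sub_self]

theorem convex_closedFace (p : V → E) (f : Finset V) : Convex ℝ (closedFace p f) := by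
  rintro P ⟨c, hc, hc1, rfl⟩ Q ⟨d, hd, hd1, rfl⟩ a b ha hb hab
  refine ⟨fun v => a * c v + b * d v, fun v hv => ?_, ?_, ?_⟩
  · have := hc v hv
    have := hd v hv
    positivity
  · rw [Finset.sum_add_distrib, ← Finset.mul_sum, ← Finset.mul_sum, hc1, hd1]
    linarith
  · simp only [add_smul, mul_smul, Finset.sum_add_distrib, Finset.smul_sum]

theorem closedFace_subset_of_convex {p : V → E} {f : Finset V} {K : Set E} (hK : Convex ℝ K)
    (h : ∀ v ∈ f, p v ∈ K) : closedFace p f ⊆ K := by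
  rintro P ⟨c, hc, hc1, rfl⟩
  exact hK.sum_mem hc hc1 h

variable [DecidableEq V]

theorem vertex_eq_sum (p : V → E) {f : Finset V} {v : V} (hv : v ∈ f) :
    ∑ u ∈ f, (Pi.single v 1 : V → ℝ) u = 1 ∧
      ∑ u ∈ f, (Pi.single v 1 : V → ℝ) u • p u = p v := by
  constructor
  · simp [Pi.single_apply, hv]
  · simp [Pi.single_apply, hv]

theorem mem_closedFace_of_mem (p : V → E) {f : Finset V} {v : V} (hv : v ∈ f) :
    p v ∈ closedFace p f :=
  ⟨Pi.single v 1, fun u _ => by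
    rw [Pi.single_apply]; split_ifs <;> norm_num, vertex_eq_sum p hv⟩

theorem closedFace_pair (p : V → E) {u v : V} (h : u ≠ v) :
    closedFace p {u, v} = segment ℝ (p u) (p v) := by
  ext P
  constructor
  · rintro ⟨c, hc, hc1, rfl⟩
    rw [Finset.sum_pair h] at hc1 ⊢
    exact ⟨c u, c v, hc u (by simp), hc v (by simp), hc1, rfl⟩
  · rintro ⟨a, b, ha, hb, hab, rfl⟩
    refine ⟨fun x => if x = u then a else b, ?_, ?_, ?_⟩
    · intro x _
      dsimp only
      split_ifs <;> assumption
    · rw [Finset.sum_pair h]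
      simpa [h.symm] using hab
    · rw [Finset.sum_pair h]
      simp [h.symm]

/-- A point with nonnegative coordinates, the one at `v` being zero, lies on the side opposite to
`v`. -/
theorem mem_closedFace_erase {p : V → E} {f : Finset V} {c : V → ℝ} (hc : ∀ u ∈ f, 0 ≤ c u)
    (hc1 : ∑ u ∈ f, c u = 1) {v : V} (hv : v ∈ f) (h0 : c v = 0) :
    ∑ u ∈ f, c u • p u ∈ closedFace p (f.erase v) := by
  refine ⟨c, fun u hu => hc u (Finset.mem_of_mem_erase hu), ?_, ?_⟩
  · rw [← hc1, ← Finset.add_sum_erase f c hv, h0, zero_add]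
  · rw [← Finset.add_sum_erase f (fun u => c u • p u) hv, h0, zero_smul, zero_add]

theorem mem_openFace_or_mem_side {p : V → E} {f : Finset V} {P : E} (hP : P ∈ closedFace p f) :
    P ∈ openFace p f ∨ ∃ v ∈ f, P ∈ closedFace p (f.erase v) := by
  obtain ⟨c, hc, hc1, rfl⟩ := hP
  by_cases h : ∀ v ∈ f, 0 < c v
  · exact Or.inl ⟨c, h, hc1, rfl⟩
  · push Not at h
    obtain ⟨v, hv, hv0⟩ := h
    exact Or.inr ⟨v, hv, mem_closedFace_erase hc hc1 hv (le_antisymm hv0 (hc v hv))⟩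

/-- A segment that leaves a simplex meets one of its sides. -/
theorem exists_mem_segment_mem_side {p : V → E} {f : Finset V}
    (hcoord : ∀ P : E, ∃ c : V → ℝ, ∑ v ∈ f, c v = 1 ∧ ∑ v ∈ f, c v • p v = P) {P R : E}
    (hR : R ∈ closedFace p f) (hP : P ∉ openFace p f) :
    ∃ X ∈ segment ℝ R P, ∃ v ∈ f, X ∈ closedFace p (f.erase v) := by
  obtain ⟨c, hc, hc1, rfl⟩ := hR
  obtain ⟨d, hd1, rfl⟩ := hcoord P
  have hne : (f.filter fun v => d v ≤ 0).Nonempty := by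
    by_contra hcon
    rw [Finset.not_nonempty_iff_eq_empty, Finset.filter_eq_empty_iff] at hcon
    exact hP ⟨d, fun v hv => not_le.1 (hcon hv), hd1, rfl⟩
  -- The quotient is the time at which coordinate `v` vanishes on the way from `c` to `d`; the
  -- smallest one marks the first exit.
  obtain ⟨v, hv, hmin⟩ := Finset.exists_min_image _ (fun v => c v / (c v - d v)) hne
  rw [Finset.mem_filter] at hv
  obtain ⟨hvf, hv0⟩ := hv
  have hcv := hc v hvf
  set t := c v / (c v - d v) with ht
  have ht0 : 0 ≤ t := div_nonneg hcv (by linarith)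
  have ht1 : t ≤ 1 := div_le_one_of_le₀ (by linarith) (by linarith)
  have hsum1 : ∑ u ∈ f, ((1 - t) * c u + t * d u) = 1 := by
    rw [Finset.sum_add_distrib, ← Finset.mul_sum, ← Finset.mul_sum, hc1, hd1]
    ring
  refine ⟨∑ u ∈ f, ((1 - t) * c u + t * d u) • p u, ⟨1 - t, t, by linarith, ht0, by ring, ?_⟩,
    v, hvf, mem_closedFace_erase ?_ hsum1 hvf ?_⟩
  · simp only [add_smul, mul_smul, Finset.sum_add_distrib, Finset.smul_sum]
  · intro u hu
    have hcu := hc u hu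
    rcases le_or_gt (d u) 0 with hdu | hdu
    · have hle := hmin u (Finset.mem_filter.2 ⟨hu, hdu⟩)
      -- Equality forces `c u = d u = 0`: the quotient is then 0 / 0 = 0, and the coordinate
      -- vanishes all along the segment.
      rcases (show 0 ≤ c u - d u by linarith).eq_or_lt with h0 | hpos
      · have h1 : c u = 0 := by linarith
        have h2 : d u = 0 := by linarith
        simp [h1, h2]
      · have := (le_div_iff₀ hpos).1 hle
        nlinarith
    · have : 0 ≤ 1 - t := by linarith
      positivity
  · rcases (show 0 ≤ c v - d v by linarith).eq_or_lt with h0 | hpos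
    · have h1 : c v = 0 := by linarith
      have h2 : d v = 0 := by linarith
      simp [h1, h2]
    · have : t * (c v - d v) = c v := div_mul_cancel₀ _ hpos.ne'
      linarith

/-- The vertices of a simplex are extreme points. -/
theorem InGeneralPosition.eq_of_mem_openSegment {p : V → E} {f : Finset V}
    (h : InGeneralPosition p f) {v : V} (hv : v ∈ f) {P R : E} (hP : P ∈ closedFace p f)
    (hR : R ∈ closedFace p f) (hm : p v ∈ openSegment ℝ P R) : P = p v := by
  obtain ⟨c, hc, hc1, rfl⟩ := hP
  obtain ⟨d, hd, hd1, rfl⟩ := hR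
  obtain ⟨a, b, ha, hb, hab, he⟩ := hm
  obtain ⟨hs1, hs⟩ := vertex_eq_sum p hv
  have key := h.coord_unique (c := fun u => a * c u + b * d u) (d := Pi.single v 1) (by
    rw [hs1, Finset.sum_add_distrib, ← Finset.mul_sum, ← Finset.mul_sum, hc1, hd1]
    linarith) (by
    rw [hs, ← he]
    simp only [add_smul, mul_smul, Finset.sum_add_distrib, Finset.smul_sum])
  have hz : ∀ u ∈ f, u ≠ v → c u = 0 := by
    intro u hu huv
    have h1 := key u hu
    simp only [Pi.single_apply, huv, if_false] at h1
    have h2 := hc u hu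
    have h3 := mul_nonneg hb.le (hd u hu)
    have h4 := mul_nonneg ha.le h2
    have h5 : a * c u = 0 := by linarith
    exact (mul_eq_zero.1 h5).resolve_left ha.ne'
  have hcv : c v = 1 := by
    rw [← hc1]
    exact (Finset.sum_eq_single v hz (fun h => absurd hv h)).symm
  rw [Finset.sum_eq_single v (fun u hu huv => by rw [hz u hu huv, zero_smul])
    (fun h => absurd hv h), hcv, one_smul]

theorem InGeneralPosition.vertex_notMem_openFace {p : V → E} {f : Finset V}
    (h : InGeneralPosition p f) {v u : V} (hv : v ∈ f) (hu : u ∈ f) (huv : u ≠ v) :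
    p v ∉ openFace p f := by
  rintro ⟨c, hc, hc1, hcv⟩
  obtain ⟨hs1, hs⟩ := vertex_eq_sum p hv
  have h1 := h.coord_unique (hc1.trans hs1.symm) (hcv.trans hs.symm) u hu
  simp only [Pi.single_apply, huv, if_false] at h1
  exact (hc u hu).ne' h1

/-- Substituting the expansion of `q w` converts coordinates on a piece of the subdivision into
coordinates on `f`. The target is an arbitrary module so that the constant function 1 also yields
the rule for coefficient sums. -/
theorem sum_subdivision {M : Type*} [AddCommGroup M] [Module ℝ M] (q : V → M) {f : Finset V}
    {d : V → ℝ} {w x : V} (hw : w ∉ f) (hx : x ∈ f) (hd : ∑ v ∈ f, d v • q v = q w)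
    (e : V → ℝ) :
    ∑ v ∈ insert w (f.erase x), e v • q v =
      ∑ v ∈ f, (e w * d v + if v = x then 0 else e v) • q v := by
  rw [Finset.sum_insert (fun h => hw (Finset.mem_of_mem_erase h))]
  simp only [add_smul, mul_smul, Finset.sum_add_distrib]
  rw [← Finset.smul_sum, hd, ← Finset.add_sum_erase f _ hx]
  simp only [if_true, zero_smul, zero_add]
  congr 1
  refine Finset.sum_congr rfl fun v hv => ?_
  rw [if_neg (Finset.ne_of_mem_erase hv)]

theorem sum_coeff_subdivision {f : Finset V} {d : V → ℝ} {w x : V} (hw : w ∉ f) (hx : x ∈ f)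
    (hd1 : ∑ v ∈ f, d v = 1) (e : V → ℝ) :
    ∑ v ∈ insert w (f.erase x), e v = ∑ v ∈ f, (e w * d v + if v = x then 0 else e v) := by
  simpa using sum_subdivision (fun _ => (1 : ℝ)) (d := d) hw hx (by simpa using hd1) e

/-! ### Subdividing a simplex at an interior point -/

section Subdivision

variable {p : V → E} {f : Finset V} {d : V → ℝ} {w x : V}

/-- With `w` in place of `x`, the coordinates of the point become `c x / d x` at `w` and `c v - (c x
/ d x) * d v` at the other vertices. Membership in a piece is thus a comparison of the ratios `c v /
d v`. -/
theorem mem_closedFace_subdivision (h : InGeneralPosition p f) (hw : w ∉ f) (hx : x ∈ f)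
    (hd0 : ∀ v ∈ f, 0 < d v) (hd1 : ∑ v ∈ f, d v = 1) (hd : ∑ v ∈ f, d v • p v = p w)
    {c : V → ℝ} (hc1 : ∑ v ∈ f, c v = 1) :
    ∑ v ∈ f, c v • p v ∈ closedFace p (insert w (f.erase x)) ↔
      0 ≤ c x ∧ ∀ v ∈ f, c x * d v ≤ c v * d x := by
  have hdx := hd0 x hx
  constructor
  · rintro ⟨e, he, he1, hep⟩
    rw [sum_subdivision p hw hx hd] at hep
    rw [sum_coeff_subdivision hw hx hd1] at he1
    have key := h.coord_unique (he1.trans hc1.symm) hep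
    have hew := he w (Finset.mem_insert_self _ _)
    have hcx := key x hx
    simp only [if_true, add_zero] at hcx
    refine ⟨by rw [← hcx]; positivity, fun v hv => ?_⟩
    have hdv := hd0 v hv
    have hcv := key v hv
    rw [← hcx, ← hcv]
    split_ifs with hvx
    · rw [hvx]; linarith
    · have := he v (Finset.mem_insert_of_mem (Finset.mem_erase.2 ⟨hvx, hv⟩))
      nlinarith [mul_nonneg this hdx.le]
  · rintro ⟨h0, hle⟩
    have hval : ∀ v ∈ f, ((fun u => if u = w then c x / d x else c u - c x / d x * d u) w * d v +
        if v = x then 0 else (fun u => if u = w then c x / d x else c u - c x / d x * d u) v)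
          = c v := by
      intro v hv
      have hvw : v ≠ w := fun hh => hw (hh ▸ hv)
      simp only [if_true, hvw, if_false]
      split_ifs with hvx
      · rw [hvx, add_zero, div_mul_cancel₀ _ hdx.ne']
      · ring
    refine ⟨fun u => if u = w then c x / d x else c u - c x / d x * d u, ?_, ?_, ?_⟩
    · intro v hv
      rcases Finset.mem_insert.1 hv with rfl | hv
      · simp only [if_true]; positivity
      · have hvf := Finset.mem_of_mem_erase hv
        have hvw : v ≠ w := fun hh => hw (hh ▸ hvf)
        simp only [hvw, if_false]
        rw [sub_nonneg, div_mul_eq_mul_div, div_le_iff₀ hdx]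
        exact hle v hvf
    · rw [sum_coeff_subdivision hw hx hd1, Finset.sum_congr rfl hval, hc1]
    · rw [sum_subdivision p hw hx hd]
      exact Finset.sum_congr rfl fun v hv => by rw [hval v hv]

theorem mem_openFace_subdivision (h : InGeneralPosition p f) (hw : w ∉ f) (hx : x ∈ f)
    (hd0 : ∀ v ∈ f, 0 < d v) (hd1 : ∑ v ∈ f, d v = 1) (hd : ∑ v ∈ f, d v • p v = p w)
    {c : V → ℝ} (hc1 : ∑ v ∈ f, c v = 1) :
    ∑ v ∈ f, c v • p v ∈ openFace p (insert w (f.erase x)) ↔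
      0 < c x ∧ ∀ v ∈ f, v ≠ x → c x * d v < c v * d x := by
  have hdx := hd0 x hx
  constructor
  · rintro ⟨e, he, he1, hep⟩
    rw [sum_subdivision p hw hx hd] at hep
    rw [sum_coeff_subdivision hw hx hd1] at he1
    have key := h.coord_unique (he1.trans hc1.symm) hep
    have hew := he w (Finset.mem_insert_self _ _)
    have hcx := key x hx
    simp only [if_true, add_zero] at hcx
    refine ⟨by rw [← hcx]; positivity, fun v hv hvx => ?_⟩
    have hcv := key v hv
    rw [← hcx, ← hcv, if_neg hvx]
    have := he v (Finset.mem_insert_of_mem (Finset.mem_erase.2 ⟨hvx, hv⟩))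
    nlinarith [mul_pos this hdx]
  · rintro ⟨h0, hlt⟩
    have hval : ∀ v ∈ f, ((fun u => if u = w then c x / d x else c u - c x / d x * d u) w * d v +
        if v = x then 0 else (fun u => if u = w then c x / d x else c u - c x / d x * d u) v)
          = c v := by
      intro v hv
      have hvw : v ≠ w := fun hh => hw (hh ▸ hv)
      simp only [if_true, hvw, if_false]
      split_ifs with hvx
      · rw [hvx, add_zero, div_mul_cancel₀ _ hdx.ne']
      · ring
    refine ⟨fun u => if u = w then c x / d x else c u - c x / d x * d u, ?_, ?_, ?_⟩
    · intro v hv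
      rcases Finset.mem_insert.1 hv with rfl | hv
      · simp only [if_true]; positivity
      · have hvf := Finset.mem_of_mem_erase hv
        have hvw : v ≠ w := fun hh => hw (hh ▸ hvf)
        simp only [hvw, if_false]
        rw [sub_pos, div_mul_eq_mul_div, div_lt_iff₀ hdx]
        exact hlt v hvf (Finset.ne_of_mem_erase hv)
    · rw [sum_coeff_subdivision hw hx hd1, Finset.sum_congr rfl hval, hc1]
    · rw [sum_subdivision p hw hx hd]
      exact Finset.sum_congr rfl fun v hv => by rw [hval v hv]

theorem openFace_subdivision_subset (hw : w ∉ f) (hx : x ∈ f) (hwo : p w ∈ openFace p f) :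
    openFace p (insert w (f.erase x)) ⊆ openFace p f := by
  obtain ⟨d, hd0, hd1, hd⟩ := hwo
  rintro P ⟨e, he, he1, rfl⟩
  have hew := he w (Finset.mem_insert_self _ _)
  refine ⟨_, fun v hv => ?_, (sum_coeff_subdivision hw hx hd1 e).symm.trans he1,
    (sum_subdivision p hw hx hd e).symm⟩
  have := mul_pos hew (hd0 v hv)
  split_ifs with hvx
  · linarith
  · have := he v (Finset.mem_insert_of_mem (Finset.mem_erase.2 ⟨hvx, hv⟩))
    linarith

/-- The piece that omits a vertex minimizing `c v / d v` contains the point. -/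
theorem closedFace_subset_iUnion_subdivision (h : InGeneralPosition p f) (hw : w ∉ f)
    (hne : f.Nonempty) (hwo : p w ∈ openFace p f) {P : E} (hP : P ∈ closedFace p f) :
    ∃ x ∈ f, P ∈ closedFace p (insert w (f.erase x)) := by
  obtain ⟨d, hd0, hd1, hd⟩ := hwo
  obtain ⟨c, hc, hc1, rfl⟩ := hP
  obtain ⟨x, hx, hmin⟩ := Finset.exists_min_image f (fun v => c v / d v) hne
  refine ⟨x, hx, (mem_closedFace_subdivision h hw hx hd0 hd1 hd hc1).2
    ⟨hc x hx, fun v hv => ?_⟩⟩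
  have := hmin v hv
  rwa [div_le_div_iff₀ (hd0 x hx) (hd0 v hv)] at this

/-- The first membership makes the ratio `c / d` strictly smaller at `x` than at `y`; the second
would give the reverse weak inequality. -/
theorem openFace_disjoint_closedFace_subdivision (h : InGeneralPosition p f) (hw : w ∉ f)
    (hwo : p w ∈ openFace p f) {y : V} (hx : x ∈ f) (hy : y ∈ f) (hxy : x ≠ y) {P : E}
    (hP : P ∈ openFace p (insert w (f.erase x))) :
    P ∉ closedFace p (insert w (f.erase y)) := by
  obtain ⟨c, -, hc1, rfl⟩ := openFace_subdivision_subset hw hx hwo hP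
  obtain ⟨d, hd0, hd1, hd⟩ := hwo
  intro hP'
  have h1 := ((mem_openFace_subdivision h hw hx hd0 hd1 hd hc1).1 hP).2 y hy hxy.symm
  have h2 := ((mem_closedFace_subdivision h hw hy hd0 hd1 hd hc1).1 hP').2 x hx
  linarith

theorem center_notMem_openFace_subdivision (h : InGeneralPosition p f) (hw : w ∉ f)
    (hwo : p w ∈ openFace p f) {y : V} (hx : x ∈ f) (hy : y ∈ f) (hxy : x ≠ y) :
    p w ∉ openFace p (insert w (f.erase x)) := fun hP =>
  openFace_disjoint_closedFace_subdivision h hw hwo hx hy hxy hP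
    (mem_closedFace_of_mem p (Finset.mem_insert_self _ _))

/-- The edge from `x` to the new vertex `w`, prolonged beyond `w`, enters the face opposite
to `x`. -/
theorem eventually_mem_openFace_subdivision (h : InGeneralPosition p f) (hw : w ∉ f) (hx : x ∈ f)
    (hwo : p w ∈ openFace p f) :
    ∀ᶠ ε : ℝ in 𝓝[>] 0, p w + ε • (p w - p x) ∈ openFace p (insert w (f.erase x)) := by
  obtain ⟨d, hd0, hd1, hd⟩ := hwo
  have hdx := hd0 x hx
  have hlim : ∀ᶠ ε : ℝ in 𝓝[>] 0, 0 < d x + ε * (d x - 1) := by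
    have hc : ContinuousAt (fun ε : ℝ => d x + ε * (d x - 1)) 0 := by fun_prop
    exact (hc.tendsto.mono_left nhdsWithin_le_nhds).eventually
      (lt_mem_nhds (by simpa using hdx))
  filter_upwards [hlim, self_mem_nhdsWithin] with ε hε hε0
  have hε0 : 0 < ε := hε0
  obtain ⟨hs1, hs⟩ := vertex_eq_sum p hx
  -- Moving away from `x` multiplies every other coordinate by `1 + ε` and decreases only the one at
  -- `x`, so that its ratio to `d` becomes the unique smallest.
  have hrep : p w + ε • (p w - p x) =
      ∑ v ∈ f, (d v + ε * (d v - (Pi.single x 1 : V → ℝ) v)) • p v := by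
    simp only [add_smul, mul_smul, sub_smul, Finset.sum_add_distrib, ← Finset.smul_sum,
      Finset.sum_sub_distrib]
    rw [hd, hs]
  rw [hrep, mem_openFace_subdivision h hw hx hd0 hd1 hd]
  · simp only [Pi.single_eq_same]
    refine ⟨hε, fun v hv hvx => ?_⟩
    have hdv := hd0 v hv
    rw [Pi.single_eq_of_ne hvx]
    nlinarith [mul_pos hε0 hdv]
  · rw [Finset.sum_add_distrib, ← Finset.mul_sum, Finset.sum_sub_distrib, hd1, hs1]
    ring

end Subdivision

end Faces

theorem InGeneralPosition.notMem_side_of_mem_openFace {V E : Type*} [AddCommGroup E] [Module ℝ E]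
    [DecidableEq V] {p : V → E} {f : Finset V} (h : InGeneralPosition p f) {v : V} (hv : v ∈ f)
    {P : E} (hP : P ∈ openFace p f) : P ∉ closedFace p (f.erase v) := by
  rintro ⟨d, -, hd1, hdP⟩
  obtain ⟨c, hc, hc1, rfl⟩ := hP
  have key := h.coord_unique (c := c) (d := fun u => if u = v then 0 else d u)
    (by
      rw [hc1, ← hd1, ← Finset.add_sum_erase f _ hv]
      simp only [if_true, zero_add]
      exact Finset.sum_congr rfl fun u hu => by rw [if_neg (Finset.ne_of_mem_erase hu)])
    (by
      rw [← hdP, ← Finset.add_sum_erase f (fun u => (if u = v then 0 else d u) • p u) hv]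
      simp only [if_true, zero_smul, zero_add]
      exact Finset.sum_congr rfl fun u hu => by rw [if_neg (Finset.ne_of_mem_erase hu)])
    v hv
  simp only [if_true] at key
  exact (hc v hv).ne' key

/-- In the plane, three points in general position provide barycentric coordinates. -/
theorem InGeneralPosition.exists_coord {V : Type*} [DecidableEq V] {p : V → Plane} {f : Finset V}
    (h : InGeneralPosition p f) (hf : f.card = 3) (P : Plane) :
    ∃ c : V → ℝ, ∑ v ∈ f, c v = 1 ∧ ∑ v ∈ f, c v • p v = P := by
  -- General position is injectivity of `L`; both sides have dimension 3, so `L` is also surjective.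
  let L : (f → ℝ) →ₗ[ℝ] ℝ × Plane :=
    { toFun := fun c => (∑ v, c v, ∑ v, c v • p v)
      map_add' := fun c d => by
        simp [add_smul, Finset.sum_add_distrib]
      map_smul' := fun a c => by
        simp [mul_smul, Finset.mul_sum, Finset.smul_sum] }
  have hext : ∀ c : f → ℝ, ∃ d : V → ℝ, (∀ v : f, d v = c v) := fun c =>
    ⟨fun v => if hv : v ∈ f then c ⟨v, hv⟩ else 0, fun v => by simp⟩
  have hinj : Function.Injective L := by
    rw [← LinearMap.ker_eq_bot, LinearMap.ker_eq_bot']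
    intro c hc
    obtain ⟨d, hd⟩ := hext c
    have h1 : ∑ v, c v = 0 := congrArg Prod.fst hc
    have h2 : ∑ v : f, c v • p v = 0 := congrArg Prod.snd hc
    simp only [← hd] at h1 h2
    rw [Finset.sum_coe_sort f d] at h1
    rw [Finset.sum_coe_sort f (fun v => d v • p v)] at h2
    funext v
    rw [← hd]
    exact h d h1 h2 v v.2
  have hsurj : Function.Surjective L :=
    (LinearMap.injective_iff_surjective_of_finrank_eq_finrank (by simp [hf])).1 hinj
  obtain ⟨c, hc⟩ := hsurj (1, P)
  obtain ⟨d, hd⟩ := hext c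
  have h1 : ∑ v, c v = 1 := congrArg Prod.fst hc
  have h2 : ∑ v : f, c v • p v = P := congrArg Prod.snd hc
  simp only [← hd] at h1 h2
  rw [Finset.sum_coe_sort f d] at h1
  rw [Finset.sum_coe_sort f (fun v => d v • p v)] at h2
  exact ⟨d, h1, h2⟩

/-! ### Triangles in a straight-line drawing -/

namespace SimpleGraph

variable {V : Type*} {G : SimpleGraph V} {p : V → Plane}

theorem IsStraightLineDrawing.eq_or_eq_of_mem (hD : G.IsStraightLineDrawing p) {u v x : V}
    (h : G.Adj u v) (hx : p x ∈ segment ℝ (p u) (p v)) : x = u ∨ x = v :=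
  Sym2.mem_iff.1 (hD.2.1 s(u, v) h x hx)

theorem IsStraightLineDrawing.exists_common (hD : G.IsStraightLineDrawing p) {u v x y : V}
    (h : G.Adj u v) (h' : G.Adj x y) (hne : s(u, v) ≠ s(x, y)) {P : Plane}
    (hP : P ∈ segment ℝ (p u) (p v)) (hP' : P ∈ segment ℝ (p x) (p y)) :
    ∃ z, (z = u ∨ z = v) ∧ (z = x ∨ z = y) ∧ p z = P := by
  obtain ⟨z, ⟨h1, h2⟩, hz⟩ := hD.2.2 s(u, v) h s(x, y) h' hne ⟨hP, hP'⟩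
  exact ⟨z, Sym2.mem_iff.1 h1, Sym2.mem_iff.1 h2, hz⟩

/-- If `α ≠ 0`, then `β` and `γ` having compatible signs would put `p a` on the edge `bc`. If `α =
0`, then `γ = -β` and the sign condition forces both to vanish. -/
theorem IsStraightLineDrawing.coeff_eq_zero (hD : G.IsStraightLineDrawing p) {a b c : V}
    (hab : a ≠ b) (hac : a ≠ c) (hbc : G.Adj b c) {α β γ : ℝ} (hs : α + (β + γ) = 0)
    (hp : α • p a + (β • p b + γ • p c) = 0) (hβγ : 0 ≤ β * γ) : α = 0 ∧ β = 0 ∧ γ = 0 := by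
  have hα : α = 0 := by
    by_contra hα
    have hα' : α = -(β + γ) := by linarith
    have hmem : p a ∈ segment ℝ (p b) (p c) := by
      refine ⟨-β / α, -γ / α, ?_, ?_, ?_, ?_⟩
      · rw [← mul_div_mul_right _ _ hα]
        exact div_nonneg (by rw [hα']; nlinarith [sq_nonneg β]) (mul_self_nonneg α)
      · rw [← mul_div_mul_right _ _ hα]
        exact div_nonneg (by rw [hα']; nlinarith [sq_nonneg γ]) (mul_self_nonneg α)
      · rw [← add_div, div_eq_one_iff_eq hα]
        linarith
      · have h1 : α • p a = (-β) • p b + (-γ) • p c := by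
          rw [neg_smul, neg_smul, ← neg_add]
          exact eq_neg_of_add_eq_zero_left hp
        have h2 : p a = α⁻¹ • (α • p a) := by rw [smul_smul, inv_mul_cancel₀ hα, one_smul]
        rw [h2, h1, smul_add, smul_smul, smul_smul]
        congr 2 <;> ring
    rcases hD.eq_or_eq_of_mem hbc hmem with h | h
    · exact hab h
    · exact hac h
  have hβ : β = 0 := by
    have : γ = -β := by linarith
    rw [this] at hβγ
    nlinarith
  exact ⟨hα, hβ, by linarith⟩

section

variable [DecidableEq V]

theorem IsNClique.exists_side {f : Finset V} (hf : G.IsNClique 3 f) {v : V} (hv : v ∈ f)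
    (p : V → Plane) :
    ∃ a b, f.erase v = {a, b} ∧ G.Adj a b ∧ a ≠ v ∧ b ≠ v ∧ a ∈ f ∧ b ∈ f ∧
      closedFace p (f.erase v) = segment ℝ (p a) (p b) := by
  obtain ⟨a, b, hab, he⟩ := Finset.card_eq_two.1
    (show (f.erase v).card = 2 by rw [Finset.card_erase_of_mem hv, hf.card_eq])
  have ha : a ∈ f.erase v := by simp [he]
  have hb : b ∈ f.erase v := by simp [he]
  rw [Finset.mem_erase] at ha hb
  exact ⟨a, b, he, hf.isClique ha.2 hb.2 hab, ha.1, hb.1, ha.2, hb.2, by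
    rw [he, closedFace_pair p hab]⟩

theorem IsStraightLineDrawing.inGeneralPosition (hD : G.IsStraightLineDrawing p) {f : Finset V}
    (hf : G.IsNClique 3 f) : InGeneralPosition p f := by
  intro c hs hp
  obtain ⟨x, y, z, hxy, hxz, hyz, rfl⟩ := is3Clique_iff.1 hf
  have h1 := hxy.ne
  have h2 := hxz.ne
  have h3 := hyz.ne
  rw [Finset.sum_insert (by simp [h1, h2]), Finset.sum_pair h3] at hs hp
  -- Among three reals some two have a nonnegative product, so `coeff_eq_zero` applies after a
  -- permutation.
  have key : c x = 0 ∧ c y = 0 ∧ c z = 0 := by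
    rcases le_or_gt 0 (c y * c z) with h | h
    · exact hD.coeff_eq_zero h1 h2 hyz hs hp h
    rcases le_or_gt 0 (c x * c z) with h' | h'
    · have := hD.coeff_eq_zero h1.symm h3 hxz (α := c y) (β := c x) (γ := c z) (by linarith)
        (by rw [← hp]; abel) h'
      exact ⟨this.2.1, this.1, this.2.2⟩
    · have h'' : 0 ≤ c x * c y := by
        by_contra hneg
        push Not at hneg
        nlinarith [mul_pos_of_neg_of_neg h h', sq_nonneg (c z)]
      have := hD.coeff_eq_zero h2.symm h3.symm hxy (α := c z) (β := c x) (γ := c y) (by linarith)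
        (by rw [← hp]; abel) h''
      exact ⟨this.2.1, this.2.2, this.1⟩
  intro v hv
  simp only [Finset.mem_insert, Finset.mem_singleton] at hv
  rcases hv with rfl | rfl | rfl
  · exact key.1
  · exact key.2.1
  · exact key.2.2

theorem IsStraightLineDrawing.mem_openFace (hD : G.IsStraightLineDrawing p) {f : Finset V}
    (hf : G.IsNClique 3 f) {w : V} (hw : w ∉ f) (h : p w ∈ closedFace p f) :
    p w ∈ openFace p f := by
  refine (mem_openFace_or_mem_side h).resolve_right ?_
  rintro ⟨v, hv, hmem⟩
  obtain ⟨a, b, -, hab, -, -, ha, hb, hside⟩ := hf.exists_side hv p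
  rw [hside] at hmem
  rcases hD.eq_or_eq_of_mem hab hmem with rfl | rfl
  · exact hw ha
  · exact hw hb

/-- An edge whose drawing meets the boundary of a triangle that avoids one of its ends has its
other end on the triangle. -/
theorem IsStraightLineDrawing.mem_of_meets_side (hD : G.IsStraightLineDrawing p) {f : Finset V}
    (hf : G.IsNClique 3 f) {w q v : V} (hw : w ∉ f) (hwq : G.Adj w q) (hv : v ∈ f) {X : Plane}
    (hX : X ∈ segment ℝ (p w) (p q)) (hXv : X ∈ closedFace p (f.erase v)) : q ∈ f := by
  obtain ⟨a, b, -, hab, -, -, ha, hb, hside⟩ := hf.exists_side hv p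
  rw [hside] at hXv
  have hne : s(w, q) ≠ s(a, b) := by
    intro he
    have : w ∈ s(a, b) := he ▸ Sym2.mem_mk_left w q
    rcases Sym2.mem_iff.1 this with rfl | rfl
    · exact hw ha
    · exact hw hb
  obtain ⟨z, hz1, hz2, -⟩ := hD.exists_common hwq hab hne hX hXv
  have hz : z ∈ f := by rcases hz2 with rfl | rfl <;> assumption
  rcases hz1 with rfl | rfl
  · exact absurd hz hw
  · exact hz

/-- Travelling from `r` to `u`, the edge meets a side of the triangle. It is that side, or meets it
in a common endpoint; this endpoint is `u`, because reaching `v` on the way to `u` would force `r =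
p v`. -/
theorem IsStraightLineDrawing.mem_of_meets_openFace (hD : G.IsStraightLineDrawing p)
    {f : Finset V} (hf : G.IsNClique 3 f) {u v : V} (huv : G.Adj u v) (hu : p u ∉ openFace p f)
    (hv : p v ∉ openFace p f) {r : Plane} (hr : r ∈ openFace p f)
    (hruv : r ∈ segment ℝ (p u) (p v)) : u ∈ f := by
  have hgp := hD.inGeneralPosition hf
  obtain ⟨X, hX, y, hy, hXy⟩ := exists_mem_segment_mem_side (hgp.exists_coord hf.card_eq)
    (openFace_subset_closedFace p f hr) hu
  obtain ⟨a, b, -, hab, -, -, ha, hb, hside⟩ := hf.exists_side hy p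
  have hmem : ∀ z, z = a ∨ z = b → z ∈ f := by
    rintro z (rfl | rfl) <;> assumption
  rw [hside] at hXy
  by_cases he : s(u, v) = s(a, b)
  · exact hmem u (Sym2.mem_iff.1 (he ▸ Sym2.mem_mk_left u v))
  have hXuv : X ∈ segment ℝ (p u) (p v) :=
    (convex_segment (p u) (p v)).segment_subset hruv (left_mem_segment ℝ _ _) hX
  obtain ⟨z, hz1, hz2, hz⟩ := hD.exists_common huv hab he hXuv hXy
  rcases hz1 with rfl | rfl
  · exact hmem z hz2
  · exfalso
    rw [← hz] at hX
    have h1 : Wbtw ℝ r (p z) (p u) := mem_segment_iff_wbtw.1 hX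
    have h2 : Wbtw ℝ (p z) r (p u) := mem_segment_iff_wbtw.1 (by rwa [segment_symm])
    have h3 := (wbtw_swap_left_iff ℝ (p u)).1 ⟨h1, h2⟩
    exact hv (h3 ▸ hr)

/-- A triangle without vertices in its interior has no edges there either. -/
theorem IsStraightLineDrawing.segment_disjoint_openFace (hD : G.IsStraightLineDrawing p)
    {f : Finset V} (hf : G.IsNClique 3 f) {u v : V} (huv : G.Adj u v)
    (hu : p u ∉ openFace p f) (hv : p v ∉ openFace p f) {r : Plane} (hr : r ∈ openFace p f) :
    r ∉ segment ℝ (p u) (p v) := by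
  intro hruv
  have huf := hD.mem_of_meets_openFace hf huv hu hv hr hruv
  have hvf := hD.mem_of_meets_openFace hf huv.symm hv hu hr (by rwa [segment_symm])
  -- Both ends are corners, so the edge lies on the side opposite the third corner `y`, away from
  -- the interior.
  have hcard : ((f.erase u).erase v).card = 1 := by
    rw [Finset.card_erase_of_mem (Finset.mem_erase.2 ⟨huv.ne', hvf⟩),
      Finset.card_erase_of_mem huf, hf.card_eq]
  obtain ⟨y, hy⟩ := Finset.card_eq_one.1 hcard
  have hy' : y ∈ (f.erase u).erase v := by simp [hy]
  simp only [Finset.mem_erase] at hy'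
  refine (hD.inGeneralPosition hf).notMem_side_of_mem_openFace hy'.2.2 hr ?_
  refine (convex_closedFace p (f.erase y)).segment_subset ?_ ?_ hruv
  · exact mem_closedFace_of_mem p (Finset.mem_erase.2 ⟨hy'.2.1.symm, huf⟩)
  · exact mem_closedFace_of_mem p (Finset.mem_erase.2 ⟨hy'.1.symm, hvf⟩)

/-- Of four pairwise adjacent vertices, one is drawn inside the triangle of the others. -/
theorem IsStraightLineDrawing.mem_openFace_or_exists (hD : G.IsStraightLineDrawing p)
    {f : Finset V} (hf : G.IsNClique 3 f) {w : V} (hw : w ∉ f) (hadj : ∀ v ∈ f, G.Adj w v) :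
    p w ∈ openFace p f ∨ ∃ c ∈ f, p c ∈ openFace p (insert w (f.erase c)) := by
  obtain ⟨d, hd1, hd⟩ := (hD.inGeneralPosition hf).exists_coord hf.card_eq (p w)
  by_cases hpos : ∀ v ∈ f, 0 ≤ d v
  · exact Or.inl (hD.mem_openFace hf hw ⟨d, hpos, hd1, hd⟩)
  right
  push Not at hpos
  obtain ⟨v, hv, hdv⟩ := hpos
  obtain ⟨a, b, he, hab, hav, hbv, ha, hb, hside⟩ := hf.exists_side hv p
  by_cases hpos' : ∀ u ∈ f, u ≠ v → 0 ≤ d u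
  · exfalso
    -- Only the coordinate at `v` is negative. It vanishes at time `t` on the way from `w` to `v`,
    -- where the edge `wv` would cross the opposite side.
    set t := -d v / (1 - d v) with ht
    have h1v : 0 < 1 - d v := by linarith
    have ht0 : 0 ≤ t := div_nonneg (by linarith) h1v.le
    have ht1 : t ≤ 1 := div_le_one_of_le₀ (by linarith) h1v.le
    have htv : t * (1 - d v) = -d v := div_mul_cancel₀ _ h1v.ne'
    obtain ⟨hs1, hs⟩ := vertex_eq_sum p hv
    have hmem : ∑ u ∈ f, ((1 - t) * d u + t * (Pi.single v 1 : V → ℝ) u) • p u ∈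
        closedFace p (f.erase v) := by
      refine mem_closedFace_erase ?_ ?_ hv ?_
      · intro u hu
        by_cases huv : u = v
        · subst huv
          simp only [Pi.single_eq_same]
          linarith
        · rw [Pi.single_eq_of_ne huv]
          have := mul_nonneg (sub_nonneg.2 ht1) (hpos' u hu huv)
          linarith
      · rw [Finset.sum_add_distrib, ← Finset.mul_sum, ← Finset.mul_sum, hs1, hd1]
        ring
      · simp only [Pi.single_eq_same]
        linarith
    have heq : ∑ u ∈ f, ((1 - t) * d u + t * (Pi.single v 1 : V → ℝ) u) • p u =
        (1 - t) • p w + t • p v := by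
      simp only [add_smul, mul_smul, Finset.sum_add_distrib, ← Finset.smul_sum]
      rw [hd, hs]
    rw [heq, hside] at hmem
    have hseg : (1 - t) • p w + t • p v ∈ segment ℝ (p w) (p v) :=
      ⟨1 - t, t, by linarith, ht0, by ring, rfl⟩
    have hwa : w ≠ a := fun h => hw (h ▸ ha)
    have hwb : w ≠ b := fun h => hw (h ▸ hb)
    have hne : s(w, v) ≠ s(a, b) := by
      intro h
      have : w ∈ s(a, b) := h ▸ Sym2.mem_mk_left w v
      rcases Sym2.mem_iff.1 this with h | h
      · exact hwa h
      · exact hwb h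
    obtain ⟨z, hz1, hz2, -⟩ := hD.exists_common (hadj v hv) hab hne hseg hmem
    rcases hz1 with rfl | rfl <;> rcases hz2 with rfl | rfl
    · exact hwa rfl
    · exact hwb rfl
    · exact hav rfl
    · exact hbv rfl
  · push Not at hpos'
    obtain ⟨u, hu, huv, hdu⟩ := hpos'
    -- Two coordinates are negative. Solving the expansion of `p w` for `p c` gives positive
    -- coefficients at `w`, `v`, `u`.
    have main : ∀ c, f.erase v = {u, c} → u ≠ c → c ≠ v → c ∈ f →
        ∃ c ∈ f, p c ∈ openFace p (insert w (f.erase c)) := by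
      intro c hec huc hcv hcf
      have hf' : f = {v, u, c} := by rw [← hec, Finset.insert_erase hv]
      have hec' : f.erase c = {v, u} := by
        rw [hf']
        ext x
        simp only [Finset.mem_erase, Finset.mem_insert, Finset.mem_singleton]
        constructor
        · rintro ⟨h1, h | h | h⟩
          · exact Or.inl h
          · exact Or.inr h
          · exact absurd h h1
        · rintro (rfl | rfl)
          · exact ⟨hcv.symm, Or.inl rfl⟩
          · exact ⟨huc, Or.inr (Or.inl rfl)⟩
      have hwv : w ≠ v := fun h => hw (h ▸ hv)
      have hwu : w ≠ u := fun h => hw (h ▸ hu)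
      have hexp : ∀ {M : Type} [AddCommMonoid M] (g : V → M),
          ∑ x ∈ f, g x = g v + (g u + g c) := by
        intro M _ g
        rw [hf', Finset.sum_insert (by simp [huv.symm, hcv.symm]), Finset.sum_pair huc]
      have hexp' : ∀ {M : Type} [AddCommMonoid M] (g : V → M),
          ∑ x ∈ insert w (f.erase c), g x = g w + (g v + g u) := by
        intro M _ g
        rw [hec', Finset.sum_insert (by simp [hwv, hwu]), Finset.sum_pair huv.symm]
      rw [hexp] at hd1 hd
      have hdc : 0 < d c := by linarith
      refine ⟨c, hcf, fun x => if x = w then 1 / d c else -d x / d c, ?_, ?_, ?_⟩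
      · intro x hx
        rw [hec'] at hx
        simp only [Finset.mem_insert, Finset.mem_singleton] at hx
        rcases hx with rfl | rfl | rfl
        · simp only [if_true]; positivity
        · simp only [if_neg hwv.symm]; exact div_pos (by linarith) hdc
        · simp only [if_neg hwu.symm]; exact div_pos (by linarith) hdc
      · rw [hexp', if_pos rfl, if_neg hwv.symm, if_neg hwu.symm, ← add_div, ← add_div,
          div_eq_one_iff_eq hdc.ne']
        linarith
      · rw [hexp']
        simp only [if_true, if_neg hwv.symm, if_neg hwu.symm]
        have h1 : p c = (d c)⁻¹ • (d c • p c) := by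
          rw [smul_smul, inv_mul_cancel₀ hdc.ne', one_smul]
        have h2 : d c • p c = p w - d v • p v - d u • p u := by
          rw [← hd]; abel
        rw [h1, h2]
        module
    have hu' : u ∈ f.erase v := Finset.mem_erase.2 ⟨huv, hu⟩
    rw [he] at hu'
    simp only [Finset.mem_insert, Finset.mem_singleton] at hu'
    rcases hu' with rfl | rfl
    · exact main b he hab.ne hbv hb
    · exact main a (by rw [he, Finset.pair_comm]) hab.ne' hav ha

end

end SimpleGraph

/-! ### Ports and ends of segments -/

namespace SimpleGraph

variable {V : Type*} {G : SimpleGraph V} {p : V → Plane}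

/-- The edge from `d.1` to `d.2` is not continued straight beyond `d.2`. -/
def IsPort (G : SimpleGraph V) (p : V → Plane) (d : V × V) : Prop :=
  G.Adj d.1 d.2 ∧ ∀ u, G.Adj d.2 u → ∀ k : ℝ, 0 < k → p u - p d.2 ≠ k • (p d.2 - p d.1)

theorem exists_drawingSegment [Finite V] (hp : Function.Injective p) {u v : V} (h : G.Adj u v) :
    ∃ S ∈ G.drawingSegments p, s(u, v) ∈ S := by
  have h0 : G.FormsSegment p {s(u, v)} :=
    ⟨Set.singleton_subset_iff.2 h, p u, p v, fun he => h.ne (hp he), by simp [edgeSegment]⟩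
  obtain ⟨S, hS, hmax⟩ := (Set.toFinite {S | G.FormsSegment p S}).exists_le_maximal h0
  exact ⟨S, hmax, hS rfl⟩

/-- A port is an end of the segment that contains its edge. -/
theorem IsPort.eq_or_eq [Finite V] (hD : G.IsStraightLineDrawing p) {z v : V}
    (hport : G.IsPort p (z, v)) {S : Set (Sym2 V)} (hS : S ⊆ G.edgeSet) {a b : Plane}
    (hU : (⋃ e ∈ S, edgeSegment p e) = segment ℝ a b) (he : s(z, v) ∈ S) :
    p v = a ∨ p v = b := by
  have hsub : segment ℝ (p z) (p v) ⊆ segment ℝ a b := by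
    rw [← hU]
    exact Set.subset_biUnion_of_mem (u := fun e => edgeSegment p e) he
  have hz := hsub (left_mem_segment ℝ _ _)
  have hv := hsub (right_mem_segment ℝ _ _)
  rw [segment_eq_image_lineMap] at hz hv
  obtain ⟨r, hr, hrz⟩ := hz
  obtain ⟨s, hs, hsv⟩ := hv
  rcases hs.1.eq_or_lt with h0 | h0
  · left; rw [← hsv, ← h0, AffineMap.lineMap_apply_zero]
  rcases hs.2.eq_or_lt with h1 | h1
  · right; rw [← hsv, h1, AffineMap.lineMap_apply_one]
  exfalso
  -- If `p v` is not an end, the segment continues beyond it.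
  have hext : ∀ᶠ ε : ℝ in 𝓝[>] 0, p v + ε • (p v - p z) ∈ segment ℝ a b := by
    have hc : Tendsto (fun ε : ℝ => s + ε * (s - r)) (𝓝[>] 0) (𝓝 s) := by
      have : ContinuousAt (fun ε : ℝ => s + ε * (s - r)) 0 := by fun_prop
      simpa using this.tendsto.mono_left nhdsWithin_le_nhds
    filter_upwards [hc.eventually (Icc_mem_nhds h0 h1)] with ε hε
    rw [segment_eq_image_lineMap]
    refine ⟨_, hε, ?_⟩
    rw [← hsv, ← hrz]
    simp only [AffineMap.lineMap_apply_module]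
    module
  -- There are finitely many edges, so a single one contains prolongation points arbitrarily close
  -- to `p v`. Being closed, it contains `p v`, hence is incident to `v` and continues the port.
  have hfreq : ∃ f ∈ S, ∃ᶠ ε : ℝ in 𝓝[>] 0, p v + ε • (p v - p z) ∈ edgeSegment p f := by
    by_contra hcon
    push Not at hcon
    have hall : ∀ᶠ ε : ℝ in 𝓝[>] 0, ∀ f ∈ S, p v + ε • (p v - p z) ∉ edgeSegment p f := by
      rw [Filter.eventually_all_finite (Set.toFinite S)]
      exact hcon
    obtain ⟨ε, hε1, hε2⟩ := (hext.and hall).exists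
    rw [← hU] at hε1
    simp only [Set.mem_iUnion] at hε1
    obtain ⟨f, hf, hmem⟩ := hε1
    exact hε2 f hf hmem
  obtain ⟨f, hfS, hf⟩ := hfreq
  have hclosed : IsClosed (edgeSegment p f) := by
    induction f using Sym2.ind with
    | _ x y =>
      have : IsCompact (segment ℝ (p x) (p y)) := by
        rw [← convexHull_pair]
        exact (Set.toFinite _).isCompact_convexHull (𝕜 := ℝ)
      exact this.isClosed
  have hlim : Tendsto (fun ε : ℝ => p v + ε • (p v - p z)) (𝓝[>] 0) (𝓝 (p v)) := by
    have : ContinuousAt (fun ε : ℝ => p v + ε • (p v - p z)) 0 := by fun_prop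
    simpa using this.tendsto.mono_left nhdsWithin_le_nhds
  have hvf : p v ∈ edgeSegment p f := hclosed.mem_of_frequently_of_tendsto hf hlim
  have hvmem := hD.2.1 f (hS hfS) v hvf
  obtain ⟨u, rfl⟩ := hvmem
  have hadj : G.Adj v u := hS hfS
  obtain ⟨ε, hε, hε0⟩ := (hf.and_eventually self_mem_nhdsWithin).exists
  have hε0 : 0 < ε := hε0
  obtain ⟨α, β, hα, hβ, hαβ, hsum⟩ := hε
  have hkey : β • (p u - p v) = ε • (p v - p z) := by
    have hα' : α = 1 - β := by linarith
    rw [hα'] at hsum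
    have : β • (p u - p v) = ((1 - β) • p v + β • p u) - p v := by module
    rw [this, hsum]
    module
  rcases hβ.eq_or_lt with h | h
  · rw [← h, zero_smul] at hkey
    rcases smul_eq_zero.1 hkey.symm with h' | h'
    · exact hε0.ne' h'
    · exact hport.1.ne' (hD.1 (sub_eq_zero.1 h'))
  · refine hport.2 u hadj (ε / β) (by positivity) ?_
    rw [div_eq_inv_mul, mul_smul]
    change p u - p v = β⁻¹ • (ε • (p v - p z))
    rw [← hkey, smul_smul, inv_mul_cancel₀ h.ne', one_smul]

/-- Two edges at a common end of a segment coincide. -/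
theorem IsStraightLineDrawing.eq_of_mem_segment (hD : G.IsStraightLineDrawing p) {z z' v : V}
    (h : G.Adj z v) (h' : G.Adj z' v) {b : Plane} (hz : p z ∈ segment ℝ (p v) b)
    (hz' : p z' ∈ segment ℝ (p v) b) : z = z' := by
  rw [mem_segment_iff_wbtw] at hz hz'
  -- Of two edges on a common ray from `p v`, the longer contains the far end of the shorter.
  have key : ∀ {x y : V}, G.Adj x v → G.Adj y v → Wbtw ℝ (p v) (p x) (p y) → x = y := by
    intro x y hx hy hw
    rcases hD.eq_or_eq_of_mem hy.symm (mem_segment_iff_wbtw.2 hw) with h | h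
    · exact absurd h hx.ne
    · exact h
  have hray : ∀ r s : ℝ, 0 ≤ r → r ≤ s → Wbtw ℝ (p v) (AffineMap.lineMap (p v) b r)
      (AffineMap.lineMap (p v) b s) := by
    intro r s hr hrs
    rcases hr.eq_or_lt with h0 | h0
    · rw [← h0, AffineMap.lineMap_apply_zero]
      exact wbtw_self_left ℝ _ _
    · refine ⟨r / s, ⟨div_nonneg hr (hr.trans hrs), div_le_one_of_le₀ hrs (by linarith)⟩, ?_⟩
      have : r = r / s * s := (div_mul_cancel₀ _ (by linarith)).symm
      simp only [AffineMap.lineMap_apply_module']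
      conv_rhs => rw [this]
      module
  obtain ⟨r, hr, hrz⟩ := hz
  obtain ⟨s, hs, hsz⟩ := hz'
  rcases le_total r s with h1 | h1
  · exact key h h' (by rw [← hrz, ← hsz]; exact hray r s hr.1 h1)
  · exact (key h' h (by rw [← hrz, ← hsz]; exact hray s r hs.1 h1)).symm

/-- A drawing has at least half as many segments as ports. -/
theorem card_le_two_mul_encard_drawingSegments [Finite V] (hD : G.IsStraightLineDrawing p)
    (D : Finset (V × V)) (hport : ∀ d ∈ D, G.IsPort p d) :
    (D.card : ℕ∞) ≤ 2 * (G.drawingSegments p).encard := by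
  classical
  have hfin : (G.drawingSegments p).Finite := Set.toFinite _
  have hex : ∀ d : V × V, ∃ S, d ∈ D → S ∈ G.drawingSegments p ∧ s(d.1, d.2) ∈ S := by
    intro d
    by_cases hd : d ∈ D
    · obtain ⟨S, h1, h2⟩ := exists_drawingSegment hD.1 (hport d hd).1
      exact ⟨S, fun _ => ⟨h1, h2⟩⟩
    · exact ⟨∅, fun h => absurd h hd⟩
  choose F hF using hex
  have hle : D.card ≤ 2 * hfin.toFinset.card := by
    refine Finset.card_le_mul_card_image_of_maps_to (f := F)
      (fun d hd => hfin.mem_toFinset.2 (hF d hd).1) 2 fun S hS => ?_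
    obtain ⟨hSE, a, b, -, hU⟩ := (hfin.mem_toFinset.1 hS).prop
    have hmem : ∀ d ∈ D.filter fun d => F d = S, G.Adj d.1 d.2 ∧ (p d.2 = a ∨ p d.2 = b) ∧
        p d.1 ∈ segment ℝ a b := by
      intro d hd
      rw [Finset.mem_filter] at hd
      have he : s(d.1, d.2) ∈ S := hd.2 ▸ (hF d hd.1).2
      refine ⟨(hport d hd.1).1, IsPort.eq_or_eq hD (hport d hd.1) hSE hU he, ?_⟩
      rw [← hU]
      exact Set.mem_biUnion he (left_mem_segment ℝ _ _)
    -- The ports assigned to `S` are told apart by their heads, which lie at its two ends.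
    calc (D.filter fun d => F d = S).card
        ≤ ({a, b} : Finset Plane).card := by
          refine Finset.card_le_card_of_injOn (fun d => p d.2) ?_ ?_
          · intro d hd
            have := (hmem d hd).2.1
            simpa using this
          · rintro ⟨z, v⟩ hd ⟨z', v'⟩ hd' heq
            obtain ⟨h1, h2, h3⟩ := hmem _ hd
            obtain ⟨h1', -, h3'⟩ := hmem _ hd'
            obtain rfl : v = v' := hD.1 heq
            rcases h2 with rfl | rfl
            · exact Prod.ext (hD.eq_of_mem_segment h1 h1' h3 h3') rfl
            · rw [segment_symm] at h3 h3'
              exact Prod.ext (hD.eq_of_mem_segment h1 h1' h3 h3') rfl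
      _ ≤ 2 := Finset.card_le_two
  rw [← hfin.coe_toFinset, Set.encard_coe_eq_coe_finsetCard]
  exact_mod_cast hle

/-! ### Stacking orders of 3-trees -/

/-- The vertex sets of 3-trees, built up from a 4-clique by stacking. -/
inductive IsStacked [DecidableEq V] (G : SimpleGraph V) : Finset V → Prop
  | base {S : Finset V} : G.IsNClique 4 S → IsStacked G S
  | stack {S Q : Finset V} {w : V} : IsStacked G S → w ∉ S → Q ⊆ S → G.IsNClique 3 Q →
      (∀ u ∈ S, G.Adj w u ↔ u ∈ Q) → IsStacked G (insert w S)

theorem IsKTree.isStacked [Fintype V] [DecidableEq V] (h : G.IsKTree 3) :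
    G.IsStacked Finset.univ := by
  obtain ⟨hn, σ, hbase, hstep⟩ := h
  have key : ∀ m, 4 ≤ m → m ≤ Fintype.card V →
      G.IsStacked ((Finset.univ.filter fun i : Fin (Fintype.card V) => i.val < m).image σ) := by
    intro m hm
    induction m, hm using Nat.le_induction with
    | base =>
      intro h4
      refine .base ⟨by simpa using hbase, ?_⟩
      rw [Finset.card_image_of_injective _ σ.injective, Fin.card_filter_val_lt]
      omega
    | succ m hm ih =>
      intro hlt
      have hlt : m < Fintype.card V := hlt
      obtain ⟨Q, hQ, hQn⟩ := hstep ⟨m, hlt⟩ hm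
      have hset : (Finset.univ.filter fun i : Fin (Fintype.card V) => i.val < m + 1).image σ =
          insert (σ ⟨m, hlt⟩)
            ((Finset.univ.filter fun i : Fin (Fintype.card V) => i.val < m).image σ) := by
        rw [← Finset.image_insert]
        congr 1
        ext i
        simp only [Finset.mem_filter, Finset.mem_univ, true_and, Finset.mem_insert, Fin.ext_iff]
        omega
      have hQ' : ∀ u, u ∈ Q ↔ G.Adj (σ ⟨m, hlt⟩) u ∧
          u ∈ (Finset.univ.filter fun i : Fin (Fintype.card V) => i.val < m).image σ := by
        intro u
        rw [← Finset.mem_coe, ← hQn, ← Finset.mem_coe (s := Finset.image _ _), Finset.coe_image,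
          Finset.coe_filter]
        simp only [Finset.mem_univ, true_and]
        rfl
      rw [hset]
      refine .stack (ih hlt.le) ?_ (fun u hu => ((hQ' u).1 hu).2) hQ fun u hu => ?_
      · simp only [Finset.mem_image, Finset.mem_filter, Finset.mem_univ, true_and,
          EmbeddingLike.apply_eq_iff_eq, not_exists, not_and]
        rintro i hi rfl
        exact lt_irrefl _ hi
      · rw [hQ']
        exact ⟨fun h => ⟨h, hu⟩, fun h => h.1⟩
  have := key _ hn le_rfl
  convert this
  symm
  rw [Finset.eq_univ_iff_forall]
  intro v
  exact Finset.mem_image.2 ⟨σ.symm v, by simp, by simp⟩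

theorem IsStacked.four_le_card [DecidableEq V] {S : Finset V} (h : G.IsStacked S) :
    4 ≤ S.card := by
  induction h with
  | base h => exact h.card_eq.ge
  | stack _ hw _ _ _ ih => rw [Finset.card_insert_of_notMem hw]; omega

/-! ### Degree sums of edges and triangles -/

section Degree

variable [DecidableEq V] [DecidableRel G.Adj]

/-- The number of neighbours of `v` in `S`. -/
def degreeIn (G : SimpleGraph V) [DecidableRel G.Adj] (S : Finset V) (v : V) : ℕ :=
  (S.filter (G.Adj v)).card

theorem degreeIn_insert {S : Finset V} {w : V} (hw : w ∉ S) (v : V) :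
    G.degreeIn (insert w S) v = G.degreeIn S v + if G.Adj v w then 1 else 0 := by
  unfold degreeIn
  rw [Finset.filter_insert]
  split_ifs with h
  · rw [Finset.card_insert_of_notMem (by simp [hw])]
  · rfl

theorem degreeIn_insert_self {S Q : Finset V} {w : V} (hQ : Q ⊆ S)
    (hadj : ∀ u ∈ S, G.Adj w u ↔ u ∈ Q) : G.degreeIn (insert w S) w = Q.card := by
  unfold degreeIn
  congr 1
  ext u
  simp only [Finset.mem_filter, Finset.mem_insert]
  constructor
  · rintro ⟨rfl | hu, h⟩
    · exact absurd h (G.loopless.irrefl u)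
    · exact (hadj u hu).1 h
  · intro hu
    exact ⟨Or.inr (hQ hu), (hadj u (hQ hu)).2 hu⟩

theorem degreeIn_insert_of_mem {S Q : Finset V} {w : V} (hw : w ∉ S)
    (hadj : ∀ u ∈ S, G.Adj w u ↔ u ∈ Q) {v : V} (hv : v ∈ S) :
    G.degreeIn (insert w S) v = G.degreeIn S v + if v ∈ Q then 1 else 0 := by
  rw [degreeIn_insert hw]
  simp only [G.adj_comm v w, hadj v hv]

theorem IsStacked.three_le_degreeIn {S : Finset V} (h : G.IsStacked S) :
    ∀ v ∈ S, 3 ≤ G.degreeIn S v := by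
  induction h with
  | @base S h =>
    intro v hv
    have : S.filter (G.Adj v) = S.erase v := by
      ext u
      simp only [Finset.mem_filter, Finset.mem_erase]
      exact ⟨fun hu => ⟨hu.2.ne', hu.1⟩, fun hu => ⟨hu.2, h.isClique hv hu.2 hu.1.symm⟩⟩
    rw [degreeIn, this, Finset.card_erase_of_mem hv, h.card_eq]
  | @stack S Q w hS hw hQ hQ3 hadj ih =>
    intro v hv
    rcases Finset.mem_insert.1 hv with rfl | hv
    · rw [degreeIn_insert_self hQ hadj, hQ3.card_eq]
    · rw [degreeIn_insert_of_mem hw hadj hv]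
      exact (ih v hv).trans (Nat.le_add_right _ _)

/-- From five vertices on, no two vertices of degree 3 are adjacent. A neighbour of the new vertex
has just gained an edge; when the fifth vertex is stacked, `Q` misses only one old vertex and so
meets every old edge. -/
theorem IsStacked.seven_le_degreeIn {S : Finset V} (h : G.IsStacked S) (h5 : 5 ≤ S.card) :
    ∀ u ∈ S, ∀ v ∈ S, G.Adj u v → 7 ≤ G.degreeIn S u + G.degreeIn S v := by
  induction h with
  | base h => exact absurd h.card_eq (by omega)
  | @stack S Q w hS hw hQ hQ3 hadj ih =>
    have hnew : ∀ v ∈ S, G.Adj w v →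
        7 ≤ G.degreeIn (insert w S) w + G.degreeIn (insert w S) v := by
      intro v hv hwv
      rw [degreeIn_insert_self hQ hadj, hQ3.card_eq, degreeIn_insert_of_mem hw hadj hv,
        if_pos ((hadj v hv).1 hwv)]
      have := hS.three_le_degreeIn v hv
      omega
    intro u hu v hv huv
    rcases Finset.mem_insert.1 hu with rfl | hu' <;>
      rcases Finset.mem_insert.1 hv with rfl | hv'
    · exact absurd huv (G.loopless.irrefl _)
    · exact hnew v hv' huv
    · rw [add_comm]
      exact hnew u hu' huv.symm
    · rw [degreeIn_insert_of_mem hw hadj hv', degreeIn_insert_of_mem hw hadj hu']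
      have h1 := hS.three_le_degreeIn u hu'
      have h2 := hS.three_le_degreeIn v hv'
      by_cases h5S : 5 ≤ S.card
      · have := ih h5S u hu' v hv' huv
        omega
      · have hone : u ∈ Q ∨ v ∈ Q := by
          by_contra hcon
          push Not at hcon
          have hsub : insert u (insert v Q) ⊆ S := by
            intro x hx
            simp only [Finset.mem_insert] at hx
            rcases hx with rfl | rfl | hx
            exacts [hu', hv', hQ hx]
          have := Finset.card_le_card hsub
          rw [Finset.card_insert_of_notMem (by simp [hcon.1, huv.ne]),
            Finset.card_insert_of_notMem hcon.2, hQ3.card_eq] at this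
          omega
        rcases hone with h | h <;> rw [if_pos h] <;> omega

theorem sum_degreeIn_insert {S Q T : Finset V} {w : V} (hw : w ∉ S)
    (hadj : ∀ u ∈ S, G.Adj w u ↔ u ∈ Q) (hT : T ⊆ S) :
    ∑ v ∈ T, G.degreeIn (insert w S) v = ∑ v ∈ T, G.degreeIn S v + (T ∩ Q).card := by
  rw [Finset.sum_congr rfl fun v hv => degreeIn_insert_of_mem hw hadj (hT hv),
    Finset.sum_add_distrib]
  congr 1
  rw [Finset.card_eq_sum_ones, ← Finset.sum_filter, Finset.filter_mem_eq_inter]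

theorem card_add_card_le_card_add_card_inter {S Q T : Finset V} (hT : T ⊆ S) (hQ : Q ⊆ S) :
    T.card + Q.card ≤ S.card + (T ∩ Q).card := by
  rw [← Finset.card_union_add_card_inter]
  exact Nat.add_le_add_right (Finset.card_le_card (Finset.union_subset hT hQ)) _

/-- The degree sum of a triangle through the vertex stacked last. -/
theorem IsStacked.le_sum_degreeIn_of_mem {S Q T : Finset V} {w : V} {m : ℕ} (hw : w ∉ S)
    (hQ : Q ⊆ S) (hQ3 : G.IsNClique 3 Q) (hadj : ∀ u ∈ S, G.Adj w u ↔ u ∈ Q)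
    (hm : ∀ u ∈ S, ∀ v ∈ S, G.Adj u v → m ≤ G.degreeIn S u + G.degreeIn S v)
    (hT3 : G.IsNClique 3 T) (hT : T ⊆ insert w S) (hwT : w ∈ T) :
    m + 5 ≤ ∑ v ∈ T, G.degreeIn (insert w S) v := by
  obtain ⟨a, b, he, hab, haw, hbw, ha, hb, -⟩ := hT3.exists_side hwT (fun _ => (0 : Plane))
  have hS : ∀ x ∈ T, x ≠ w → x ∈ S := fun x hx hxw =>
    (Finset.mem_insert.1 (hT hx)).resolve_left hxw
  have hQm : ∀ x ∈ T, x ≠ w → x ∈ Q := fun x hx hxw =>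
    (hadj x (hS x hx hxw)).1 (hT3.isClique hwT hx hxw.symm)
  -- The 5 is the degree 3 of `w` plus one new edge at each of the other two corners.
  rw [← Finset.add_sum_erase T _ hwT, he, Finset.sum_pair hab.ne, degreeIn_insert_self hQ hadj,
    hQ3.card_eq, degreeIn_insert_of_mem hw hadj (hS a ha haw),
    degreeIn_insert_of_mem hw hadj (hS b hb hbw), if_pos (hQm a ha haw), if_pos (hQm b hb hbw)]
  have := hm a (hS a ha haw) b (hS b hb hbw) hab
  omega

/-- Through the new vertex, 6 + 5 = 11. Otherwise, at the fifth vertex, two triples among four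
vertices share at least two, so the old sum 9 grows by 2. -/
theorem IsStacked.eleven_le_sum_degreeIn {S : Finset V} (h : G.IsStacked S) (h5 : 5 ≤ S.card) :
    ∀ T ⊆ S, G.IsNClique 3 T → 11 ≤ ∑ v ∈ T, G.degreeIn S v := by
  induction h with
  | base h => exact absurd h.card_eq (by omega)
  | @stack S Q w hS hw hQ hQ3 hadj ih =>
    intro T hT hT3
    have h3 := hS.three_le_degreeIn
    by_cases hwT : w ∈ T
    · refine IsStacked.le_sum_degreeIn_of_mem (m := 6) hw hQ hQ3 hadj (fun u hu v hv _ => ?_) hT3 hT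
        hwT
      have := h3 u hu
      have := h3 v hv
      omega
    · have hTS : T ⊆ S := (Finset.subset_insert_iff_of_notMem hwT).1 hT
      rw [sum_degreeIn_insert hw hadj hTS]
      by_cases h5S : 5 ≤ S.card
      · exact (ih h5S T hTS hT3).trans (Nat.le_add_right _ _)
      · have h1 := card_add_card_le_card_add_card_inter hTS hQ
        have h2 : T.card • 3 ≤ ∑ v ∈ T, G.degreeIn S v :=
          Finset.card_nsmul_le_sum T _ 3 fun v hv => h3 v (hTS hv)
        rw [hT3.card_eq, hQ3.card_eq] at h1
        rw [hT3.card_eq, smul_eq_mul] at h2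
        rw [Finset.card_insert_of_notMem hw] at h5
        omega

/-- Through the new vertex, 7 + 5 = 12. Otherwise, at the sixth vertex, two triples among five
vertices share at least one, so the old sum 11 grows by 1. -/
theorem IsStacked.twelve_le_sum_degreeIn {S : Finset V} (h : G.IsStacked S) (h6 : 6 ≤ S.card) :
    ∀ T ⊆ S, G.IsNClique 3 T → 12 ≤ ∑ v ∈ T, G.degreeIn S v := by
  induction h with
  | base h => exact absurd h.card_eq (by omega)
  | @stack S Q w hS hw hQ hQ3 hadj ih =>
    intro T hT hT3
    have h5 : 5 ≤ S.card := by
      rw [Finset.card_insert_of_notMem hw] at h6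
      omega
    by_cases hwT : w ∈ T
    · exact IsStacked.le_sum_degreeIn_of_mem (m := 7) hw hQ hQ3 hadj (hS.seven_le_degreeIn h5) hT3
        hT hwT
    · have hTS : T ⊆ S := (Finset.subset_insert_iff_of_notMem hwT).1 hT
      rw [sum_degreeIn_insert hw hadj hTS]
      by_cases h6S : 6 ≤ S.card
      · exact (ih h6S T hTS hT3).trans (Nat.le_add_right _ _)
      · have h1 := card_add_card_le_card_add_card_inter hTS hQ
        rw [hT3.card_eq, hQ3.card_eq] at h1
        have h2 := hS.eleven_le_sum_degreeIn h5 T hTS hT3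
        omega

end Degree

end SimpleGraph

/-! ### Drawings of 3-trees are triangulations -/

namespace SimpleGraph

variable {V : Type*} {G : SimpleGraph V} {p : V → Plane}

/-- In the drawing `p`, the subgraph induced by `S` has the outer triangle `T` and the set `F` of
triangular inner faces. If there are several inner faces, then each of them is entered by the
prolongation of some edge beyond one of its ends. -/
structure IsTriangulated (G : SimpleGraph V) (p : V → Plane) (S T : Finset V)
    (F : Finset (Finset V)) : Prop where
  outer : G.IsNClique 3 T
  outer_subset : T ⊆ S
  mem_outer : ∀ v ∈ S, p v ∈ closedFace p T
  -- A triangle has one inner face, and each stacked vertex adds two.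
  card : F.card + 5 = 2 * S.card
  face : ∀ f ∈ F, G.IsNClique 3 f
  face_subset : ∀ f ∈ F, f ⊆ S
  cover : ∀ P ∈ closedFace p T, ∃ f ∈ F, P ∈ closedFace p f
  empty : ∀ f ∈ F, ∀ v ∈ S, p v ∉ openFace p f
  disjoint : ∀ f ∈ F, ∀ g ∈ F, ∀ P, P ∈ openFace p f → P ∈ openFace p g → f = g
  dart : 1 < F.card → ∀ f ∈ F, ∃ z ∈ S, ∃ v ∈ S, G.Adj z v ∧
    ∀ᶠ ε : ℝ in 𝓝[>] 0, p v + ε • (p v - p z) ∈ openFace p f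

theorem IsTriangulated.openFace_subset {S T : Finset V} {F : Finset (Finset V)}
    (h : G.IsTriangulated p S T F) {f : Finset V} (hf : f ∈ F) :
    openFace p f ⊆ closedFace p T :=
  (openFace_subset_closedFace p f).trans (closedFace_subset_of_convex (convex_closedFace p T)
    fun v hv => h.mem_outer v (h.face_subset f hf hv))

variable [DecidableEq V]

theorem IsNClique.insert_erase_of_adj {f : Finset V} (hf : G.IsNClique 3 f) {w x : V}
    (hadj : ∀ v ∈ f, G.Adj w v) (hx : x ∈ f) : G.IsNClique 3 (insert w (f.erase x)) :=
  hf.insert_erase (fun v hv => hadj v (Finset.mem_sdiff.1 hv).1) hx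

theorem insert_erase_inj {f : Finset V} {w x y : V} (hw : w ∉ f) (hx : x ∈ f)
    (h : insert w (f.erase x) = insert w (f.erase y)) : x = y := by
  by_contra hxy
  have : x ∈ insert w (f.erase y) := Finset.mem_insert_of_mem (Finset.mem_erase.2 ⟨hxy, hx⟩)
  rw [← h, Finset.mem_insert, Finset.mem_erase] at this
  rcases this with rfl | h'
  · exact hw hx
  · exact h'.1 rfl

theorem IsStraightLineDrawing.isTriangulated_triangle (hD : G.IsStraightLineDrawing p)
    {T : Finset V} (hT : G.IsNClique 3 T) : G.IsTriangulated p T T {T} where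
  outer := hT
  outer_subset := subset_rfl
  mem_outer v hv := mem_closedFace_of_mem p hv
  card := by rw [hT.card_eq, Finset.card_singleton]
  face f hf := by rwa [Finset.mem_singleton.1 hf]
  face_subset f hf := by rw [Finset.mem_singleton.1 hf]
  cover P hP := ⟨T, Finset.mem_singleton_self T, hP⟩
  empty f hf v hv := by
    rw [Finset.mem_singleton.1 hf]
    obtain ⟨a, b, -, -, hav, -, ha, -⟩ := hT.exists_side hv p
    exact (hD.inGeneralPosition hT).vertex_notMem_openFace hv ha hav
  disjoint f hf g hg P _ _ := by rw [Finset.mem_singleton.1 hf, Finset.mem_singleton.1 hg]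
  dart h := absurd h (by simp)

/-- Stacking a vertex into an inner face. -/
theorem IsTriangulated.insert_inner (hD : G.IsStraightLineDrawing p) {S T Q : Finset V}
    {F : Finset (Finset V)} (h : G.IsTriangulated p S T F) {w : V} (hw : w ∉ S)
    (hQ3 : G.IsNClique 3 Q) (hQS : Q ⊆ S) (hadj : ∀ u ∈ Q, G.Adj w u)
    (hwT : p w ∈ closedFace p T) :
    ∃ F', G.IsTriangulated p (insert w S) T F' := by
  obtain ⟨f, hfF, hwf⟩ := h.cover _ hwT
  have hf := h.face f hfF
  have hfS := h.face_subset f hfF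
  have hwf' : w ∉ f := fun hh => hw (hfS hh)
  have hwo := hD.mem_openFace hf hwf' hwf
  have hgp := hD.inGeneralPosition hf
  -- No vertex lies inside `f`, so every edge from `w` to `Q` reaches the boundary of `f`, which it
  -- can do only at a corner.
  have hQf : Q = f := by
    refine Finset.eq_of_subset_of_card_le (fun q hq => ?_) (by rw [hf.card_eq, hQ3.card_eq])
    obtain ⟨X, hX, v, hv, hXv⟩ := exists_mem_segment_mem_side (hgp.exists_coord hf.card_eq)
      hwf (h.empty f hfF q (hQS hq))
    exact hD.mem_of_meets_side hf hwf' (hadj q hq) hv hX hXv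
  subst hQf
  have hne : ∀ x ∈ Q, ∃ y ∈ Q, x ≠ y := by
    intro x hx
    obtain ⟨a, -, -, -, hav, -, ha, -⟩ := hf.exists_side hx p
    exact ⟨a, ha, hav.symm⟩
  have hsub : ∀ x ∈ Q, openFace p (insert w (Q.erase x)) ⊆ openFace p Q := fun x hx =>
    openFace_subdivision_subset hwf' hx hwo
  have hnew : ∀ g, g ∈ F.erase Q ∪ Q.image (fun x => insert w (Q.erase x)) ↔
      (g ≠ Q ∧ g ∈ F) ∨ ∃ x ∈ Q, insert w (Q.erase x) = g := by
    intro g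
    simp only [Finset.mem_union, Finset.mem_erase, Finset.mem_image]
  refine ⟨F.erase Q ∪ Q.image (fun x => insert w (Q.erase x)), h.outer,
    h.outer_subset.trans (Finset.subset_insert _ _), ?_, ?_, ?_, ?_, ?_, ?_, ?_, ?_⟩
  · intro v hv
    rcases Finset.mem_insert.1 hv with rfl | hv
    · exact hwT
    · exact h.mem_outer v hv
  · have h1 := h.card
    have h2 : 0 < F.card := Finset.card_pos.2 ⟨Q, hfF⟩
    rw [Finset.card_union_of_disjoint, Finset.card_erase_of_mem hfF,
      Finset.card_image_of_injOn fun x hx y _ hxy => insert_erase_inj hwf' hx hxy, hf.card_eq,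
      Finset.card_insert_of_notMem hw]
    · omega
    · rw [Finset.disjoint_left]
      intro g hg hg'
      obtain ⟨x, -, rfl⟩ := Finset.mem_image.1 hg'
      exact hw (h.face_subset _ (Finset.mem_of_mem_erase hg) (Finset.mem_insert_self _ _))
  · intro g hg
    rcases (hnew g).1 hg with hg | ⟨x, hx, rfl⟩
    · exact h.face g hg.2
    · exact hf.insert_erase_of_adj hadj hx
  · intro g hg
    rcases (hnew g).1 hg with hg | ⟨x, hx, rfl⟩
    · exact (h.face_subset g hg.2).trans (Finset.subset_insert _ _)
    · exact Finset.insert_subset_insert _ ((Finset.erase_subset _ _).trans hfS)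
  · intro P hP
    obtain ⟨g, hg, hPg⟩ := h.cover P hP
    by_cases hgQ : g = Q
    · subst hgQ
      obtain ⟨x, hx, hPx⟩ := closedFace_subset_iUnion_subdivision hgp hwf'
        (Finset.card_pos.1 (by rw [hf.card_eq]; norm_num)) hwo hPg
      exact ⟨_, (hnew _).2 (Or.inr ⟨x, hx, rfl⟩), hPx⟩
    · exact ⟨g, (hnew g).2 (Or.inl ⟨hgQ, hg⟩), hPg⟩
  · intro g hg v hv hvg
    rcases (hnew g).1 hg with hgF | ⟨x, hx, rfl⟩ <;> rcases Finset.mem_insert.1 hv with rfl | hv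
    · exact hgF.1 (h.disjoint g hgF.2 Q hfF _ hvg hwo)
    · exact h.empty g hgF.2 v hv hvg
    · obtain ⟨y, hy, hxy⟩ := hne x hx
      exact center_notMem_openFace_subdivision hgp hwf' hwo hx hy hxy hvg
    · exact h.empty Q hfF v hv (hsub x hx hvg)
  · intro g hg g' hg' P hP hP'
    rcases (hnew g).1 hg with hg | ⟨x, hx, rfl⟩ <;>
      rcases (hnew g').1 hg' with hg' | ⟨y, hy, rfl⟩
    · exact h.disjoint g hg.2 g' hg'.2 P hP hP'
    · exact absurd (h.disjoint g hg.2 Q hfF P hP (hsub y hy hP')) hg.1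
    · exact absurd (h.disjoint g' hg'.2 Q hfF P hP' (hsub x hx hP)) hg'.1
    · by_contra hcon
      have hxy : x ≠ y := fun hh => hcon (by rw [hh])
      exact openFace_disjoint_closedFace_subdivision hgp hwf' hwo hx hy hxy hP
        (openFace_subset_closedFace _ _ hP')
  · intro _ g hg
    rcases (hnew g).1 hg with hg | ⟨x, hx, rfl⟩
    · have h1 : 1 < F.card := Finset.one_lt_card.2 ⟨g, hg.2, Q, hfF, hg.1⟩
      obtain ⟨z, hz, v, hv, hd⟩ := h.dart h1 g hg.2
      exact ⟨z, Finset.mem_insert_of_mem hz, v, Finset.mem_insert_of_mem hv, hd⟩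
    · exact ⟨x, Finset.mem_insert_of_mem (hfS hx), w, Finset.mem_insert_self _ _,
        (hadj x hx).symm, eventually_mem_openFace_subdivision hgp hwf' hx hwo⟩

/-- Stacking a vertex onto the outer triangle. -/
theorem IsTriangulated.insert_outer (hD : G.IsStraightLineDrawing p) {S T Q : Finset V}
    {F : Finset (Finset V)} (h : G.IsTriangulated p S T F) (hS : 4 ≤ S.card) {w : V} (hw : w ∉ S)
    (hQ3 : G.IsNClique 3 Q) (hQS : Q ⊆ S) (hadj : ∀ u ∈ Q, G.Adj w u)
    (hwT : p w ∉ closedFace p T) :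
    ∃ T' F', G.IsTriangulated p (insert w S) T' F' := by
  have hwT' : w ∉ T := fun hh => hw (h.outer_subset hh)
  -- All old vertices lie in the outer triangle, so every edge from `w` meets its boundary,
  -- necessarily at a corner.
  have hQT : Q = T := by
    refine Finset.eq_of_subset_of_card_le (fun q hq => ?_) (by rw [h.outer.card_eq, hQ3.card_eq])
    obtain ⟨X, hX, v, hv, hXv⟩ := exists_mem_segment_mem_side
      ((hD.inGeneralPosition h.outer).exists_coord h.outer.card_eq) (h.mem_outer q (hQS hq))
      (fun hh => hwT (openFace_subset_closedFace _ _ hh))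
    rw [segment_symm] at hX
    exact hD.mem_of_meets_side h.outer hwT' (hadj q hq) hv hX hXv
  subst hQT
  -- The corner `c` is swallowed. Subdividing the new outer triangle at `c` gives the old outer
  -- triangle and two new faces.
  obtain ⟨c, hc, hco⟩ := (hD.mem_openFace_or_exists hQ3 hwT' hadj).resolve_left
    (fun hh => hwT (openFace_subset_closedFace _ _ hh))
  have hwc : w ≠ c := fun hh => hwT' (hh ▸ hc)
  set T := insert w (Q.erase c) with hT
  have hT3 : G.IsNClique 3 T := hQ3.insert_erase_of_adj hadj hc
  have hgp := hD.inGeneralPosition hT3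
  have hcT : c ∉ T := by simp [hT, hwc.symm]
  have hwmem : w ∈ T := Finset.mem_insert_self _ _
  have hback : insert c (T.erase w) = Q := by
    rw [hT, Finset.erase_insert (fun hh => hwT' (Finset.mem_of_mem_erase hh)),
      Finset.insert_erase hc]
  have hcadj : ∀ v ∈ T, G.Adj c v := by
    intro v hv
    rcases Finset.mem_insert.1 hv with rfl | hv
    · exact (hadj c hc).symm
    · exact hQ3.isClique hc (Finset.mem_of_mem_erase hv) (Finset.ne_of_mem_erase hv).symm
  have hTS : T ⊆ insert w S :=
    Finset.insert_subset_insert _ ((Finset.erase_subset _ _).trans hQS)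
  have hQT : closedFace p Q ⊆ closedFace p T := by
    refine closedFace_subset_of_convex (convex_closedFace p T) fun v hv => ?_
    by_cases hvc : v = c
    · rw [hvc]
      exact openFace_subset_closedFace _ _ hco
    · exact mem_closedFace_of_mem p (Finset.mem_insert_of_mem (Finset.mem_erase.2 ⟨hvc, hv⟩))
  have hne : ∀ x ∈ Q.erase c, x ∈ T ∧ x ≠ w := fun x hx =>
    ⟨Finset.mem_insert_of_mem hx, fun hh => hwT' (hh ▸ Finset.mem_of_mem_erase hx)⟩
  have hout : ∀ x ∈ Q.erase c, ∀ P ∈ openFace p (insert c (T.erase x)), P ∉ closedFace p Q := by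
    intro x hx P hP
    rw [← hback]
    exact openFace_disjoint_closedFace_subdivision hgp hcT hco (hne x hx).1 hwmem (hne x hx).2 hP
  have hnew : ∀ g, g ∈ F ∪ (Q.erase c).image (fun x => insert c (T.erase x)) ↔
      g ∈ F ∨ ∃ x ∈ Q.erase c, insert c (T.erase x) = g := by
    intro g
    simp only [Finset.mem_union, Finset.mem_image]
  refine ⟨T, F ∪ (Q.erase c).image (fun x => insert c (T.erase x)), hT3, hTS,
    ?_, ?_, ?_, ?_, ?_, ?_, ?_, ?_⟩
  · intro v hv
    rcases Finset.mem_insert.1 hv with rfl | hv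
    · exact mem_closedFace_of_mem p hwmem
    · exact hQT (h.mem_outer v hv)
  · have h1 := h.card
    rw [Finset.card_union_of_disjoint,
      Finset.card_image_of_injOn fun x hx y _ hxy => insert_erase_inj hcT (hne x hx).1 hxy,
      Finset.card_erase_of_mem hc, hQ3.card_eq, Finset.card_insert_of_notMem hw]
    · omega
    · rw [Finset.disjoint_left]
      intro g hg hg'
      obtain ⟨x, hx, rfl⟩ := Finset.mem_image.1 hg'
      exact hw (h.face_subset _ hg
        (Finset.mem_insert_of_mem (Finset.mem_erase.2 ⟨(hne x hx).2.symm, hwmem⟩)))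
  · intro g hg
    rcases (hnew g).1 hg with hg | ⟨x, hx, rfl⟩
    · exact h.face g hg
    · exact hT3.insert_erase_of_adj hcadj (hne x hx).1
  · intro g hg
    rcases (hnew g).1 hg with hg | ⟨x, hx, rfl⟩
    · exact (h.face_subset g hg).trans (Finset.subset_insert _ _)
    · exact Finset.insert_subset (Finset.mem_insert_of_mem (hQS hc))
        ((Finset.erase_subset _ _).trans hTS)
  · intro P hP
    obtain ⟨x, hx, hPx⟩ := closedFace_subset_iUnion_subdivision hgp hcT ⟨w, hwmem⟩ hco hP
    rcases Finset.mem_insert.1 hx with rfl | hx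
    · rw [hback] at hPx
      obtain ⟨g, hg, hPg⟩ := h.cover P hPx
      exact ⟨g, (hnew g).2 (Or.inl hg), hPg⟩
    · exact ⟨_, (hnew _).2 (Or.inr ⟨x, hx, rfl⟩), hPx⟩
  · intro g hg v hv hvg
    rcases (hnew g).1 hg with hgF | ⟨x, hx, rfl⟩ <;> rcases Finset.mem_insert.1 hv with rfl | hv
    · exact hwT (h.openFace_subset hgF hvg)
    · exact h.empty g hgF v hv hvg
    · exact hgp.vertex_notMem_openFace hwmem (hne x hx).1 (hne x hx).2
        (openFace_subdivision_subset hcT (hne x hx).1 hco hvg)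
    · exact hout x hx _ hvg (h.mem_outer v hv)
  · intro g hg g' hg' P hP hP'
    rcases (hnew g).1 hg with hg | ⟨x, hx, rfl⟩ <;>
      rcases (hnew g').1 hg' with hg' | ⟨y, hy, rfl⟩
    · exact h.disjoint g hg g' hg' P hP hP'
    · exact absurd (h.openFace_subset hg hP) (hout y hy P hP')
    · exact absurd (h.openFace_subset hg' hP') (hout x hx P hP)
    · by_contra hcon
      have hxy : x ≠ y := fun hh => hcon (by rw [hh])
      exact openFace_disjoint_closedFace_subdivision hgp hcT hco (hne x hx).1 (hne y hy).1 hxy hP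
        (openFace_subset_closedFace _ _ hP')
  · intro _ g hg
    rcases (hnew g).1 hg with hg | ⟨x, hx, rfl⟩
    · have h1 : 1 < F.card := by have := h.card; omega
      obtain ⟨z, hz, v, hv, hd⟩ := h.dart h1 g hg
      exact ⟨z, Finset.mem_insert_of_mem hz, v, Finset.mem_insert_of_mem hv, hd⟩
    · exact ⟨x, hTS (hne x hx).1, c, Finset.mem_insert_of_mem (hQS hc),
        (hcadj x (hne x hx).1).symm,
        eventually_mem_openFace_subdivision hgp hcT (hne x hx).1 hco⟩

/-- A drawn 4-clique is a triangle with a vertex inserted into it, so the base case reduces to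
`insert_inner`. -/
theorem IsStacked.exists_isTriangulated (hD : G.IsStraightLineDrawing p) {S : Finset V}
    (h : G.IsStacked S) : ∃ T F, G.IsTriangulated p S T F := by
  induction h with
  | @base S hS =>
    have hface : ∀ w ∈ S, G.IsNClique 3 (S.erase w) ∧ ∀ v ∈ S.erase w, G.Adj w v := by
      intro w hw
      refine ⟨⟨hS.isClique.subset (Finset.coe_subset.2 (Finset.erase_subset _ _)), ?_⟩,
        fun v hv => hS.isClique hw (Finset.mem_of_mem_erase hv) (Finset.ne_of_mem_erase hv).symm⟩
      rw [Finset.card_erase_of_mem hw, hS.card_eq]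
    have key : ∃ w ∈ S, p w ∈ openFace p (S.erase w) := by
      obtain ⟨w, hw⟩ := Finset.card_pos.1 (show 0 < S.card by rw [hS.card_eq]; norm_num)
      rcases hD.mem_openFace_or_exists (hface w hw).1 (Finset.notMem_erase w S) (hface w hw).2
        with h | ⟨c, hc, hco⟩
      · exact ⟨w, hw, h⟩
      · refine ⟨c, Finset.mem_of_mem_erase hc, ?_⟩
        rwa [Finset.erase_right_comm, Finset.insert_erase
          (Finset.mem_erase.2 ⟨(Finset.ne_of_mem_erase hc).symm, hw⟩)] at hco
    obtain ⟨w, hw, hwo⟩ := key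
    obtain ⟨F, hF⟩ := (hD.isTriangulated_triangle (hface w hw).1).insert_inner hD
      (Finset.notMem_erase w S) (hface w hw).1 subset_rfl (hface w hw).2
      (openFace_subset_closedFace _ _ hwo)
    rw [Finset.insert_erase hw] at hF
    exact ⟨_, F, hF⟩
  | @stack S Q w hS hw hQ hQ3 hadj ih =>
    obtain ⟨T, F, h⟩ := ih
    have hadj' : ∀ u ∈ Q, G.Adj w u := fun u hu => (hadj u (hQ hu)).2 hu
    by_cases hwT : p w ∈ closedFace p T
    · exact ⟨T, h.insert_inner hD hw hQ3 hQ hadj' hwT⟩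
    · exact h.insert_outer hD hS.four_le_card hw hQ3 hQ hadj' hwT

/-! ### Counting ports -/

theorem mem_openSegment_of_sub_eq {E : Type*} [AddCommGroup E] [Module ℝ E] {P X R : E} {k : ℝ}
    (hk : 0 < k) (h : R - X = k • (X - P)) : X ∈ openSegment ℝ P R := by
  refine ⟨k / (1 + k), 1 / (1 + k), by positivity, by positivity, by field_simp; ring, ?_⟩
  have hR : R = X + k • (X - P) := by rw [← h]; abel
  have h1 : 1 + k ≠ 0 := by positivity
  rw [hR, ← sub_eq_zero]
  have : (k / (1 + k)) • P + (1 / (1 + k)) • (X + k • (X - P)) - X =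
      ((1 + k) / (1 + k) - 1) • X := by module
  rw [this, div_self h1, sub_self, zero_smul]

variable [Fintype V]

/-- Every edge into a vertex of the outer triangle ends there. -/
theorem IsTriangulated.isPort_of_mem_outer (hD : G.IsStraightLineDrawing p) {T : Finset V}
    {F : Finset (Finset V)} (h : G.IsTriangulated p Finset.univ T F) {z v : V} (hv : v ∈ T)
    (hzv : G.Adj z v) : G.IsPort p (z, v) := by
  refine ⟨hzv, fun u _ k hk he => hzv.ne (hD.1 ?_)⟩
  exact (hD.inGeneralPosition h.outer).eq_of_mem_openSegment hv (h.mem_outer z (Finset.mem_univ z))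
    (h.mem_outer u (Finset.mem_univ u)) (mem_openSegment_of_sub_eq hk he)

/-- An edge continuing the dart would run into the empty face `f`. The head is no corner of `T`,
because corners are extreme and the prolongation stays within the outer triangle. -/
theorem IsTriangulated.exists_port (hD : G.IsStraightLineDrawing p) {T : Finset V}
    {F : Finset (Finset V)} (h : G.IsTriangulated p Finset.univ T F) (h1 : 1 < F.card)
    {f : Finset V} (hf : f ∈ F) :
    ∃ d : V × V, G.IsPort p d ∧ d.2 ∉ T ∧
      ∀ᶠ ε : ℝ in 𝓝[>] 0, p d.2 + ε • (p d.2 - p d.1) ∈ openFace p f := by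
  obtain ⟨z, -, v, -, hzv, hev⟩ := h.dart h1 f hf
  refine ⟨(z, v), ⟨hzv, fun u hvu k hk he => ?_⟩, fun hvT => ?_, hev⟩
  · change p u - p v = k • (p v - p z) at he
    obtain ⟨ε, ⟨hε, hε0⟩, hεk⟩ := ((hev.and self_mem_nhdsWithin).and
      (mem_nhdsWithin_of_mem_nhds (Iic_mem_nhds hk))).exists
    have hε0 : 0 < ε := hε0
    have hεk : ε ≤ k := hεk
    refine hD.segment_disjoint_openFace (h.face f hf) hvu (h.empty f hf v (Finset.mem_univ v))
      (h.empty f hf u (Finset.mem_univ u)) hε ?_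
    rw [segment_eq_image']
    refine ⟨ε / k, ⟨by positivity, div_le_one_of_le₀ hεk hk.le⟩, ?_⟩
    dsimp only
    rw [he, smul_smul, div_mul_cancel₀ _ hk.ne']
  · obtain ⟨ε, hε, hε0⟩ := (hev.and self_mem_nhdsWithin).exists
    refine hzv.ne (hD.1 ?_)
    exact (hD.inGeneralPosition h.outer).eq_of_mem_openSegment hvT
      (h.mem_outer z (Finset.mem_univ z)) (h.openFace_subset hf hε)
      (mem_openSegment_of_sub_eq (k := ε) hε0 (by abel))

theorem IsStacked.exists_ports (hD : G.IsStraightLineDrawing p)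
    (h : G.IsStacked Finset.univ) (h6 : 6 ≤ Fintype.card V) :
    ∃ D : Finset (V × V), (∀ d ∈ D, G.IsPort p d) ∧ 2 * Fintype.card V + 7 ≤ D.card := by
  classical
  obtain ⟨T, F, hT⟩ := h.exists_isTriangulated hD
  have hcard := hT.card
  rw [Finset.card_univ] at hcard
  have h1 : 1 < F.card := by omega
  have hex : ∀ f : F, ∃ d : V × V, G.IsPort p d ∧ d.2 ∉ T ∧
      ∀ᶠ ε : ℝ in 𝓝[>] 0, p d.2 + ε • (p d.2 - p d.1) ∈ openFace p f := fun f =>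
    hT.exists_port hD h1 f.2
  choose δ hport hδT hδ using hex
  -- A shared port would have prolongation points interior to both faces.
  have hinj : Function.Injective δ := by
    intro f g hfg
    have hg := hδ g
    rw [← hfg] at hg
    obtain ⟨ε, hε, hε'⟩ := ((hδ f).and hg).exists
    exact Subtype.ext (hT.disjoint f f.2 g g.2 _ hε hε')
  set D₁ := (Finset.univ : Finset F).image δ
  set D₂ := T.biUnion fun v => (Finset.univ.filter (G.Adj v)).image fun z => (z, v)
  have hD₁ : D₁.card = F.card := by
    rw [Finset.card_image_of_injective _ hinj, Finset.card_univ, Fintype.card_coe]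
  have hD₂ : D₂.card = ∑ v ∈ T, G.degreeIn Finset.univ v := by
    rw [Finset.card_biUnion]
    · refine Finset.sum_congr rfl fun v _ => ?_
      rw [Finset.card_image_of_injective _ fun a b hab => (Prod.ext_iff.1 hab).1]
      rfl
    · intro u _ v _ huv
      rw [Function.onFun, Finset.disjoint_left]
      intro d hd hd'
      obtain ⟨a, -, rfl⟩ := Finset.mem_image.1 hd
      obtain ⟨b, -, hb⟩ := Finset.mem_image.1 hd'
      exact huv (Prod.ext_iff.1 hb).2.symm
  have hmem₂ : ∀ d ∈ D₂, d.2 ∈ T ∧ G.Adj d.1 d.2 := by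
    intro d hd
    obtain ⟨v, hv, hd⟩ := Finset.mem_biUnion.1 hd
    obtain ⟨z, hz, rfl⟩ := Finset.mem_image.1 hd
    exact ⟨hv, (Finset.mem_filter.1 hz).2.symm⟩
  have hdisj : Disjoint D₁ D₂ := by
    rw [Finset.disjoint_left]
    intro d hd hd'
    obtain ⟨f, -, rfl⟩ := Finset.mem_image.1 hd
    exact hδT f (hmem₂ _ hd').1
  refine ⟨D₁ ∪ D₂, fun d hd => ?_, ?_⟩
  · rcases Finset.mem_union.1 hd with hd | hd
    · obtain ⟨f, -, rfl⟩ := Finset.mem_image.1 hd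
      exact hport f
    · exact hT.isPort_of_mem_outer hD (hmem₂ d hd).1 (hmem₂ d hd).2
  · have := h.twelve_le_sum_degreeIn (by rwa [Finset.card_univ]) T hT.outer_subset hT.outer
    rw [Finset.card_union_of_disjoint hdisj, hD₁, hD₂]
    omega

end SimpleGraph

theorem mainTheorem5 {V : Type*} [Fintype V] (G : SimpleGraph V)
    (hplanar : G.IsPlanar) (htree : G.IsKTree 3) (hn : 6 ≤ Fintype.card V) :
    ((Fintype.card V + 4 : ℕ) : ℕ∞) ≤ G.segmentNumber := by
  classical
  refine le_iInf fun p => le_iInf fun hD => ?_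
  obtain ⟨D, hport, hcard⟩ := htree.isStacked.exists_ports hD hn
  have h := SimpleGraph.card_le_two_mul_encard_drawingSegments hD D hport
  have hfin : (G.drawingSegments p).Finite := Set.toFinite _
  rw [hfin.encard_eq_coe_toFinset_card] at h ⊢
  have h' : D.card ≤ 2 * hfin.toFinset.card := by exact_mod_cast h
  -- From 2n + 7 ≤ 2s, integrality of s rounds n + 7/2 up to n + 4.
  exact_mod_cast (show Fintype.card V + 4 ≤ hfin.toFinset.card by omega)
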